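/- For a real number $t>2\pi$ put $N=\lfloor\sqrt{t/(2\pi)}\rfloor$ and $\mathcal M(t)=\sum_{n=1}^{N} e^{it\log n}/\sqrt n$. Given a positive integer $v_0\le N$ and a real number $u_0>1$, define $v_{r+1}=v_r+\lceil v_r/u_0\rceil$ for $r\ge 0$, let $R$ be the largest integer with $v_R<N+1$, and put $K_r=\lceil v_r/u_0\rceil$ for $0\le r<R$ and $K_R=\min\{\lceil v_R/u_0\rceil,\,N+1-v_R\}$. Put $$F(K,j;a,b)=\frac1{K^j}\sum_{k=0}^{K-1}k^j e^{2\pi i ak+2\pi i bk^2}\quad(0^0=1),\qquad f_s(z)=\frac{e^{(s-1/2)(z-z^2/2)}}{(1+z)^s}\quad(f_s(0)=1),$$ $$a_r=\frac{t}{2\pi v_r},\qquad b_r=-\frac{t}{4\pi v_r^2},\qquad c_r(j)=\Big(\frac{K_r}{v_r}\Big)^j\frac{f_{s^*}^{(j)}(0)}{j!},\qquad s^*=\tfrac12-it .$$ The truncation error $\epsilon_J(t)$ is defined by $$\mathcal M(t)=\sum_{n=1}^{v_0-1}\frac{e^{it\log n}}{\sqrt n}+\sum_{r=0}^{R}\frac{e^{it\log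 v_r}}{\sqrt{v_r}}\sum_{j=0}^{J}c_r(j)\,F(K_r,j;a_r,b_r)+\epsilon_J(t).$$ Proposition. Let $\alpha=1/0.9$, $K_{\min}=2000$, $s=\tfrac12+it$, and take $v_0=\lceil K_{\min}t^{1/3}\rceil$ and $u_0=\alpha|s|^{1/3}$. Then, for each of the seven heights $t$ and each of the five orders $J$ below, $|\epsilon_J(t)|$ is at most the corresponding entry of the table: $$\begin{array}{l|lllll} t & J=18 & J=21 & J=24 & J=27 & J=30\\\hline 10^{24} & 0.000831893 & 0.0000386099 & 0.0000108755 & 7.46138\times10^{-6} & 5.42799\times10^{-6}\\ 10^{26} & 0.00283154 & 0.0000925556 & 7.50489\times10^{-6} & 3.85022\times10^{-6} & 2.76739\times10^{-6}\\ 10^{28} & 0.00839067 & 0.000256977 & 9.10602\times10^{-6} & 1.82102\times10^{-6} & 1.21035\times10^{-6}\\ 10^{30} & 0.0230403 & 0.000698646 & 0.0000196934 & 1.1228\times10^{-6} & 4.96568\times10^{-7}\\ 10^{32} & 0.0603446 & 0.00182714 & 0.0000495358 & 1.44903\times10^{-6} & 2.13244\times10^{-7}\\ 10^{34} & 0.15309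 & 0.00463399 & 0.000124900 & 3.12046\times10^{-6} & 1.36063\times10^{-7}\\ 10^{36} & 0.37952 & 0.011489 & 0.00030938 & 7.53404\times10^{-6} & 1.89985\times10^{-7} \end{array}$$ -/

import Mathlib

noncomputable section

namespace RSTruncation

/-- The length `N = ⌊√(t / 2π)⌋` of the Riemann–Siegel main sum. -/
def mainLength (t : ℝ) : ℕ := ⌊Real.sqrt (t / (2 * Real.pi))⌋₊

/-- The general term `e^{i t log n} / √n`. -/
def term (t : ℝ) (n : ℕ) : ℂ :=
  Complex.exp (Complex.I * (t : ℂ) * (Real.log (n : ℝ) : ℂ)) / (Real.sqrt (n : ℝ) : ℂ)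

/-- The Riemann–Siegel main sum `M(t) = ∑_{n=1}^N e^{i t log n} / √n`. -/
def mainSum (t : ℝ) : ℂ := ∑ n ∈ Finset.Icc 1 (mainLength t), term t n

/-- The block starting points: `v_{r+1} = v_r + ⌈v_r / u₀⌉`, started at `v₀`. -/
def blockStart (u₀ : ℝ) (v₀ : ℕ) : ℕ → ℕ
  | 0 => v₀
  | r + 1 => blockStart u₀ v₀ r + ⌈(blockStart u₀ v₀ r : ℝ) / u₀⌉₊

/-- `R`, the largest index `r` with `v_r < N + 1`. -/
def lastBlock (t u₀ : ℝ) (v₀ : ℕ) : ℕ :=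
  sSup {r : ℕ | blockStart u₀ v₀ r < mainLength t + 1}

/-- The block lengths: `K_r = ⌈v_r / u₀⌉` for `r < R`, and
`K_R = min (⌈v_R / u₀⌉) (N + 1 - v_R)`. -/
def blockLength (t u₀ : ℝ) (v₀ : ℕ) (r : ℕ) : ℕ :=
  if r < lastBlock t u₀ v₀ then ⌈(blockStart u₀ v₀ r : ℝ) / u₀⌉₊
  else min ⌈(blockStart u₀ v₀ r : ℝ) / u₀⌉₊ (mainLength t + 1 - blockStart u₀ v₀ r)

/-- The quadratic exponential sum
`F(K, j; a, b) = K^{-j} ∑_{k=0}^{K-1} k^j e^{2πi a k + 2πi b k²}`, with `0 ^ 0 = 1`. -/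
def quadSum (K j : ℕ) (a b : ℝ) : ℂ :=
  1 / (K : ℂ) ^ j * ∑ k ∈ Finset.range K, (k : ℂ) ^ j *
    Complex.exp (2 * (Real.pi : ℂ) * Complex.I * (a : ℂ) * (k : ℂ)
      + 2 * (Real.pi : ℂ) * Complex.I * (b : ℂ) * (k : ℂ) ^ 2)

/-- `f_s(z) = e^{(s - 1/2)(z - z²/2)} / (1 + z)^s`, on the branch with `f_s(0) = 1`. -/
def fTaylor (s z : ℂ) : ℂ :=
  Complex.exp ((s - 1 / 2) * (z - z ^ 2 / 2)) / (1 + z) ^ s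

/-- The linear argument `a_r = t / (2π v_r)`. -/
def linArg (t u₀ : ℝ) (v₀ : ℕ) (r : ℕ) : ℝ :=
  t / (2 * Real.pi * (blockStart u₀ v₀ r : ℝ))

/-- The quadratic argument `b_r = -t / (4π v_r²)`. -/
def quadArg (t u₀ : ℝ) (v₀ : ℕ) (r : ℕ) : ℝ :=
  -(t / (4 * Real.pi * (blockStart u₀ v₀ r : ℝ) ^ 2))

/-- The coefficient `c_r(j) = (K_r / v_r)^j f_{s*}^{(j)}(0) / j!`, where `s* = 1/2 - i t`. -/
def coeff (t u₀ : ℝ) (v₀ : ℕ) (r j : ℕ) : ℂ :=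
  ((blockLength t u₀ v₀ r : ℂ) / (blockStart u₀ v₀ r : ℂ)) ^ j *
    (iteratedDeriv j (fTaylor (1 / 2 - Complex.I * (t : ℂ))) 0 / (j.factorial : ℂ))

/-- The truncated block `𝐅(K_r, 𝐜_r; a_r, b_r) = ∑_{j=0}^J c_r(j) F(K_r, j; a_r, b_r)`. -/
def truncBlock (J : ℕ) (t u₀ : ℝ) (v₀ : ℕ) (r : ℕ) : ℂ :=
  ∑ j ∈ Finset.range (J + 1), coeff t u₀ v₀ r j *
    quadSum (blockLength t u₀ v₀ r) j (linArg t u₀ v₀ r) (quadArg t u₀ v₀ r)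

/-- The truncation error: `ε_J(t)` is the main sum minus its initial part
`∑_{n=1}^{v₀-1} e^{i t log n} / √n` minus
`∑_{r=0}^R e^{i t log v_r} / √v_r · 𝐅(K_r, 𝐜_r; a_r, b_r)`. -/
def truncError (J : ℕ) (t u₀ : ℝ) (v₀ : ℕ) : ℂ :=
  mainSum t - ∑ n ∈ Finset.Ico 1 v₀, term t n
    - ∑ r ∈ Finset.range (lastBlock t u₀ v₀ + 1),
        term t (blockStart u₀ v₀ r) * truncBlock J t u₀ v₀ r

/-- The choice `u₀ = α |s|^{1/3}` with `α = 1/0.9` and `s = 1/2 + i t`. -/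
def chosenU (t : ℝ) : ℝ :=
  (1 / 0.9) * ‖(1 / 2 + Complex.I * (t : ℂ) : ℂ)‖ ^ ((1 : ℝ) / 3)

/-- The choice `v₀ = ⌈K_min t^{1/3}⌉` with `K_min = 2000`. -/
def chosenV (t : ℝ) : ℕ := ⌈(2000 : ℝ) * t ^ ((1 : ℝ) / 3)⌉₊

/-- The heights `t` labelling the rows of the table. -/
def tableT : Fin 7 → ℝ :=
  ![10 ^ 24, 10 ^ 26, 10 ^ 28, 10 ^ 30, 10 ^ 32, 10 ^ 34, 10 ^ 36]

/-- The truncation orders `J` labelling the columns of the table. -/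
def tableJ : Fin 5 → ℕ := ![18, 21, 24, 27, 30]

/-- The table of bounds, row by row. -/
def tableBound : Fin 7 → Fin 5 → ℝ :=
  ![![0.000831893, 0.0000386099, 0.0000108755, 7.46138e-6, 5.42799e-6],
    ![0.00283154, 0.0000925556, 7.50489e-6, 3.85022e-6, 2.76739e-6],
    ![0.00839067, 0.000256977, 9.10602e-6, 1.82102e-6, 1.21035e-6],
    ![0.0230403, 0.000698646, 0.0000196934, 1.1228e-6, 4.96568e-7],
    ![0.0603446, 0.00182714, 0.0000495358, 1.44903e-6, 2.13244e-7],
    ![0.15309, 0.00463399, 0.000124900, 3.12046e-6, 1.36063e-7],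
    ![0.37952, 0.011489, 0.00030938, 7.53404e-6, 1.89985e-7]]

end RSTruncation

end

/-! Writing n = v_r + k and x = k/v_r, each term factors as the term at v_r, times a quadratic phase
in k, times f(x) with f = f_{s*}. Hence the error of a block is a sum of the Taylor remainder of f
against a quadratic phase.

Near 0, f(z) is close to exp(itz³/3), because log(1+z) - z + z²/2 begins with z³/3. Every J in the
table is 3n - 3, so the degree-J Taylor polynomial of the cubic exponential is its exponential
series cut before the n-th term. The remainder of f is therefore (itx³/3)^n/n! plus two small
pieces: the exponential tail beyond n, and the Taylor remainder of f(z) - exp(itz³/3), controlled by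
Cauchy estimates on |z| = 3/u (`norm_fTaylor_sub_taylor_sub_le`).

Absolute values alone are not enough for the main piece: at t = 10^36, J = 18 they give about 0.54
against 0.37952. Cancellation in the quadratic phase is used. A van der Corput inequality with three
shifts (`norm_sum_quadPhase_le`) saves a factor √3 unless U = t/(πv_r²) lies within 1/40 of an
integer, and partial summation (`norm_sum_monotone_mul_le`) carries the monotone weight x^{3n}.
Blocks with U near an integer are bounded trivially; as √v is proportional to U^{-1/4}, a convex
function, they hold only a share of about 3/40 of the range of √v (`sum_bad_increments_le`).

Summing over blocks telescopes in √v and 1/√v (`norm_truncError_le_of_params`), and the table is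
then checked numerically. -/

/-! ### Quadratic exponential sums: van der Corput differencing and partial summation -/

-- Van der Corput's inequality with three shifts. Every term lies in exactly three of the L + 2
-- windows of length 3 that meet the sum. Cauchy–Schwarz over the windows leaves 3L diagonal terms,
-- the correlation at lag 1 twice and at lag 2 once, each with its conjugate.
open Finset in
theorem norm_sq_sum_le_three_shift (x : ℕ → ℂ) (hx : ∀ k, ‖x k‖ = 1) (L : ℕ) {B₁ B₂ : ℝ}
    (h₁ : ‖∑ k ∈ range (L - 1), x (k + 1) * (starRingEnd ℂ) (x k)‖ ≤ B₁)
    (h₂ : ‖∑ k ∈ range (L - 2), x (k + 2) * (starRingEnd ℂ) (x k)‖ ≤ B₂) :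
    ‖∑ k ∈ range L, x k‖ ^ 2 ≤ (L + 2) / 9 * (3 * L + 4 * B₁ + 2 * B₂) := by
  set X : ℕ → ℂ := fun n => if n < L then x n else 0 with hX
  -- Delaying the zero-extended sequence by 2 lets the windows that start before index 0 be indexed
  -- by `ℕ`.
  set Y : ℕ → ℂ := fun n => if n < 2 then 0 else X (n - 2) with hY
  have hY0 : Y 0 = 0 := by simp [hY]
  have hY1 : Y 1 = 0 := by simp [hY]
  have hY2 : ∀ n, Y (n + 2) = X n := fun n => by simp [hY]
  have hXL : ∀ n, n < L → X n = x n := fun n hn => by simp [hX, hn]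
  have hXz : ∀ n, L ≤ n → X n = 0 := fun n hn => by simp [hX, hn]
  have hcut : ∀ (F : ℕ → ℂ) (M d : ℕ), (∀ n, M ≤ n → F n = 0) →
      ∑ n ∈ range (M + d), F n = ∑ n ∈ range M, F n := by
    intro F M d hF
    rw [sum_range_add, add_eq_left]
    exact sum_eq_zero fun i _ => hF _ (by omega)
  have hsumX : ∑ n ∈ range L, X n = ∑ k ∈ range L, x k :=
    sum_congr rfl fun n hn => hXL n (mem_range.1 hn)
  have hthree : ∑ n ∈ range (L + 2), (Y n + Y (n + 1) + Y (n + 2)) = 3 * ∑ k ∈ range L, x k := by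
    rw [sum_add_distrib, sum_add_distrib]
    have e0 : ∑ n ∈ range (L + 2), Y n = ∑ k ∈ range L, x k := by
      rw [sum_range_succ', sum_range_succ', hY0, hY1]
      simp only [add_zero]
      rw [← hsumX]
      exact sum_congr rfl fun n _ => hY2 n
    have e1 : ∑ n ∈ range (L + 2), Y (n + 1) = ∑ k ∈ range L, x k := by
      rw [sum_range_succ', hY1, add_zero, ← hsumX, ← hcut X L 1 hXz]
      exact sum_congr rfl fun n _ => hY2 n
    have e2 : ∑ n ∈ range (L + 2), Y (n + 2) = ∑ k ∈ range L, x k := by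
      rw [← hsumX, ← hcut X L 2 hXz]
      exact sum_congr rfl fun n _ => hY2 n
    rw [e0, e1, e2]; ring
  have hexp : ∀ a b c : ℂ, ((‖a + b + c‖ ^ 2 : ℝ)) =
      ‖a‖ ^ 2 + ‖b‖ ^ 2 + ‖c‖ ^ 2 + 2 * (b * (starRingEnd ℂ) a).re
        + 2 * (c * (starRingEnd ℂ) b).re + 2 * (c * (starRingEnd ℂ) a).re := by
    intro a b c
    simp only [← Complex.normSq_eq_norm_sq, Complex.normSq_apply, Complex.add_re, Complex.add_im,
      Complex.mul_re, Complex.conj_re, Complex.conj_im]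
    ring
  have hsq : ∑ n ∈ range (L + 2), (‖Y n‖ : ℝ) ^ 2 = L ∧
      ∑ n ∈ range (L + 2), (‖Y (n + 1)‖ : ℝ) ^ 2 = L ∧
      ∑ n ∈ range (L + 2), (‖Y (n + 2)‖ : ℝ) ^ 2 = L := by
    have hb : ∑ n ∈ range L, (‖X n‖ : ℝ) ^ 2 = L := by
      rw [sum_congr rfl fun n hn => by rw [hXL n (mem_range.1 hn), hx, one_pow]]
      simp
    have hlast : ‖X L‖ = 0 := by rw [hXz L le_rfl, norm_zero]
    have hlast' : ‖X (L + 1)‖ = 0 := by rw [hXz (L + 1) (by omega), norm_zero]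
    refine ⟨?_, ?_, ?_⟩
    · rw [sum_range_succ', sum_range_succ', hY0, hY1]
      simp only [hY2, hb]; simp
    · rw [sum_range_succ', hY1, sum_range_succ]
      simp only [hY2, hb, hlast]; simp
    · rw [sum_range_succ, sum_range_succ]
      simp only [hY2, hb, hlast, hlast']; simp
  have hXX : ∀ d, ∑ n ∈ range L, X (n + d) * (starRingEnd ℂ) (X n)
      = ∑ k ∈ range (L - d), x (k + d) * (starRingEnd ℂ) (x k) := by
    intro d
    have hz : ∀ n, L - d ≤ n → X (n + d) * (starRingEnd ℂ) (X n) = 0 := by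
      intro n hn
      rw [hXz (n + d) (by omega), zero_mul]
    have : ∑ n ∈ range L, X (n + d) * (starRingEnd ℂ) (X n)
        = ∑ n ∈ range (L - d), X (n + d) * (starRingEnd ℂ) (X n) := by
      conv_lhs => rw [show L = (L - d) + (L - (L - d)) by omega]
      exact hcut _ _ _ hz
    rw [this]
    refine sum_congr rfl fun n hn => ?_
    have := mem_range.1 hn
    rw [hXL _ (by omega), hXL _ (by omega)]
  have hXX' : ∀ d j, ∑ n ∈ range (L + j), X (n + d) * (starRingEnd ℂ) (X n)
      = ∑ k ∈ range (L - d), x (k + d) * (starRingEnd ℂ) (x k) := by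
    intro d j
    rw [← hXX]
    exact hcut _ L j fun n hn => by rw [hXz n hn, map_zero, mul_zero]
  have c01 : ∑ n ∈ range (L + 2), Y (n + 1) * (starRingEnd ℂ) (Y n)
      = ∑ k ∈ range (L - 1), x (k + 1) * (starRingEnd ℂ) (x k) := by
    rw [sum_range_succ', sum_range_succ', hY0, hY1, map_zero, mul_zero, mul_zero, add_zero,
      add_zero, ← hXX]
    exact sum_congr rfl fun n _ => by rw [show n + 1 + 1 + 1 = (n + 1) + 2 by ring, hY2, hY2]
  have c12 : ∑ n ∈ range (L + 2), Y (n + 2) * (starRingEnd ℂ) (Y (n + 1))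
      = ∑ k ∈ range (L - 1), x (k + 1) * (starRingEnd ℂ) (x k) := by
    rw [sum_range_succ', hY1, map_zero, mul_zero, add_zero, ← hXX' 1 1]
    exact sum_congr rfl fun n _ => by rw [show n + 1 + 1 = n + 2 by ring, hY2, hY2]
  have c02 : ∑ n ∈ range (L + 2), Y (n + 2) * (starRingEnd ℂ) (Y n)
      = ∑ k ∈ range (L - 2), x (k + 2) * (starRingEnd ℂ) (x k) := by
    rw [sum_range_succ', sum_range_succ', hY0, hY1, map_zero, mul_zero, mul_zero, add_zero,
      add_zero, ← hXX]
    exact sum_congr rfl fun n _ => by rw [show n + 1 + 1 = n + 2 by ring, hY2, hY2]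
  have hcs : ‖∑ n ∈ range (L + 2), (Y n + Y (n + 1) + Y (n + 2))‖ ^ 2
      ≤ (L + 2) * ∑ n ∈ range (L + 2), ‖Y n + Y (n + 1) + Y (n + 2)‖ ^ 2 := by
    calc _ ≤ (∑ n ∈ range (L + 2), ‖Y n + Y (n + 1) + Y (n + 2)‖) ^ 2 := by
          gcongr; exact norm_sum_le _ _
      _ ≤ _ := by
          have := sq_sum_le_card_mul_sum_sq (s := range (L + 2))
            (f := fun n => ‖Y n + Y (n + 1) + Y (n + 2)‖)
          simpa using this
  have hval : ∑ n ∈ range (L + 2), ‖Y n + Y (n + 1) + Y (n + 2)‖ ^ 2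
      ≤ 3 * L + 4 * B₁ + 2 * B₂ := by
    simp only [hexp, sum_add_distrib, ← mul_sum, ← Complex.re_sum]
    rw [hsq.1, hsq.2.1, hsq.2.2, c01, c12, c02]
    have r1 := (Complex.re_le_norm _).trans h₁
    have r2 := (Complex.re_le_norm _).trans h₂
    linarith
  rw [hthree, norm_mul, mul_pow] at hcs
  have h3 : ‖(3 : ℂ)‖ = 3 := by simp
  rw [h3] at hcs
  have := mul_le_mul_of_nonneg_left hval (show (0 : ℝ) ≤ (L : ℝ) + 2 by positivity)
  nlinarith

theorem norm_geom_sum_le_of_norm_eq_one {ζ : ℂ} (hζ : ‖ζ‖ = 1) (h1 : ζ ≠ 1) (n : ℕ) :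
    ‖∑ k ∈ Finset.range n, ζ ^ k‖ ≤ 2 / ‖ζ - 1‖ := by
  rw [geom_sum_eq h1, norm_div]
  gcongr
  calc ‖ζ ^ n - 1‖ ≤ ‖ζ ^ n‖ + ‖(1 : ℂ)‖ := norm_sub_le _ _
    _ = 2 := by rw [norm_pow, hζ]; norm_num

/-- The summand of a quadratic exponential sum. -/
noncomputable def quadPhase (a b : ℝ) (k : ℕ) : ℂ :=
  Complex.exp (2 * (Real.pi : ℂ) * Complex.I * (a : ℂ) * (k : ℂ)
      + 2 * (Real.pi : ℂ) * Complex.I * (b : ℂ) * (k : ℂ) ^ 2)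

theorem quadPhase_eq (a b : ℝ) (k : ℕ) : quadPhase a b k =
    Complex.exp (((2 * Real.pi * a * k + 2 * Real.pi * b * k ^ 2 : ℝ) : ℂ) * Complex.I) := by
  rw [quadPhase]; push_cast; ring_nf

theorem norm_quadPhase (a b : ℝ) (k : ℕ) : ‖quadPhase a b k‖ = 1 := by
  rw [quadPhase_eq, Complex.norm_exp_ofReal_mul_I]

theorem quadPhase_mul_conj (a b : ℝ) (d k : ℕ) :
    quadPhase a b (k + d) * (starRingEnd ℂ) (quadPhase a b k) =
      quadPhase a b d * Complex.exp (((4 * Real.pi * b : ℝ) : ℂ) * Complex.I) ^ (d * k) := by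
  rw [quadPhase_eq, quadPhase_eq, quadPhase_eq, ← Complex.exp_conj, ← Complex.exp_add,
    ← Complex.exp_nat_mul, ← Complex.exp_add]
  congr 1
  simp only [map_mul, Complex.conj_ofReal, Complex.conj_I]
  push_cast
  ring

theorem quadPhase_add (a b : ℝ) (j k : ℕ) :
    quadPhase a b (j + k) = quadPhase a b j * quadPhase (a + 2 * b * j) b k := by
  rw [quadPhase, quadPhase, quadPhase, ← Complex.exp_add]
  congr 1
  push_cast
  ring

/-- Differencing makes the phase linear, so the correlations at lags 1 and 2 are geometric sums with
ratios ζ and ζ², where ζ = e^{4πib}. A lower bound for |ζ² - 1| controls both. -/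
theorem norm_sum_quadPhase_le (a b : ℝ) (L : ℕ) {D : ℝ} (hD : 0 < D)
    (hb : D ≤ ‖Complex.exp (((8 * Real.pi * b : ℝ) : ℂ) * Complex.I) - 1‖) :
    ‖∑ k ∈ Finset.range L, quadPhase a b k‖ ≤ (L + (1 + 10 / (3 * D))) / Real.sqrt 3 := by
  set ζ := Complex.exp (((4 * Real.pi * b : ℝ) : ℂ) * Complex.I) with hζ
  have hζ1 : ‖ζ‖ = 1 := Complex.norm_exp_ofReal_mul_I _
  have hsq : Complex.exp (((8 * Real.pi * b : ℝ) : ℂ) * Complex.I) = ζ ^ 2 := by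
    rw [hζ, ← Complex.exp_nat_mul]; congr 1; push_cast; ring
  rw [hsq] at hb
  have hfac : ‖ζ ^ 2 - 1‖ ≤ 2 * ‖ζ - 1‖ := by
    rw [show ζ ^ 2 - 1 = (ζ + 1) * (ζ - 1) by ring, norm_mul]
    gcongr
    calc ‖ζ + 1‖ ≤ ‖ζ‖ + ‖(1 : ℂ)‖ := norm_add_le _ _
      _ = 2 := by rw [hζ1]; norm_num
  have hζ2ne : ζ ^ 2 ≠ 1 := by
    intro h; rw [h] at hb; simp at hb; linarith
  have hζne : ζ ≠ 1 := by
    intro h; apply hζ2ne; rw [h]; simp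
  have hpos : 0 < ‖ζ - 1‖ := norm_pos_iff.2 (sub_ne_zero.2 hζne)
  have h1 : ‖∑ k ∈ Finset.range (L - 1), quadPhase a b (k + 1) *
      (starRingEnd ℂ) (quadPhase a b k)‖ ≤ 4 / D := by
    simp only [quadPhase_mul_conj, one_mul, ← Finset.mul_sum]
    rw [norm_mul, norm_quadPhase, one_mul]
    refine (norm_geom_sum_le_of_norm_eq_one hζ1 hζne _).trans ?_
    rw [div_le_div_iff₀ hpos hD]
    linarith
  have h2 : ‖∑ k ∈ Finset.range (L - 2), quadPhase a b (k + 2) *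
      (starRingEnd ℂ) (quadPhase a b k)‖ ≤ 2 / D := by
    simp only [quadPhase_mul_conj, pow_mul, ← Finset.mul_sum]
    rw [norm_mul, norm_quadPhase, one_mul]
    refine (norm_geom_sum_le_of_norm_eq_one (by rw [norm_pow, hζ1, one_pow]) hζ2ne _).trans ?_
    gcongr
  have h := norm_sq_sum_le_three_shift (quadPhase a b) (norm_quadPhase a b) L h1 h2
  have h3 : (0 : ℝ) < Real.sqrt 3 := by positivity
  rw [le_div_iff₀ h3]
  have hY : 0 ≤ 10 / (3 * D) := by positivity
  refine abs_le_of_sq_le_sq' ?_ (by positivity) |>.2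
  rw [mul_pow, Real.sq_sqrt (by norm_num)]
  have e : 4 * (4 / D) + 2 * (2 / D) = 6 * (10 / (3 * D)) := by field_simp; norm_num
  have : (L + 2 : ℝ) / 9 * (3 * L + 4 * (4 / D) + 2 * (2 / D))
      = (L + 2) / 3 * (L + 2 * (10 / (3 * D))) := by linear_combination (L + 2 : ℝ) / 9 * e
  rw [this] at h
  -- With Y = 10/(3D) this is (L + 2)(L + 2Y) ≤ (L + 1 + Y)², with difference (1 - Y)².
  nlinarith [sq_nonneg (1 - 10 / (3 * D))]

-- Partial summation: an increasing weight is a nonnegative combination of indicators of tails, so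
-- bounds for tail sums suffice. The slopes reassemble into the total weight, and β is multiplied by
-- the last weight only.
open Finset in
theorem norm_sum_monotone_mul_le {α β : ℝ} (K : ℕ) : ∀ (w : ℕ → ℝ) (x : ℕ → ℂ),
    Monotone w → 0 ≤ w 0 →
    (∀ j ≤ K, ‖∑ k ∈ range (K + 1 - j), x (j + k)‖ ≤ α * (K + 1 - j : ℕ) + β) →
    ‖∑ k ∈ range (K + 1), (w k : ℂ) * x k‖ ≤ α * ∑ k ∈ range (K + 1), w k + β * w K := by
  induction K with
  | zero =>
    intro w x _ h0 h
    have := h 0 le_rfl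
    simp at this
    simp [abs_of_nonneg h0]
    nlinarith
  | succ K ih =>
    intro w x hw h0 h
    have hx := h 0 (by omega)
    simp only [zero_add, tsub_zero] at hx
    -- The constant layer `w 0` is peeled off the whole sum; what is left is again a nonnegative
    -- increasing weight, starting one index later.
    have key := ih (fun k => w (k + 1) - w 0) (fun k => x (k + 1))
      (fun i j hij => sub_le_sub_right (hw (by omega)) _) (sub_nonneg.2 (hw (by omega)))
      (fun j hj => by
        have := h (j + 1) (by omega)
        rw [show K + 1 + 1 - (j + 1) = K + 1 - j by omega] at this
        simpa only [add_right_comm] using this)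
    have hdec : ∑ k ∈ range (K + 1 + 1), (w k : ℂ) * x k = (w 0 : ℂ) * ∑ k ∈ range (K + 1 + 1), x k
        + ∑ k ∈ range (K + 1), ((w (k + 1) - w 0 : ℝ) : ℂ) * x (k + 1) := by
      rw [sum_range_succ', sum_range_succ' (fun k => x k)]
      push_cast
      simp only [sub_mul, sum_sub_distrib, ← mul_sum]
      ring
    have hsum : ∑ k ∈ range (K + 1 + 1), w k
        = ∑ k ∈ range (K + 1), (w (k + 1) - w 0) + (K + 1 + 1) * w 0 := by
      rw [sum_range_succ', sum_sub_distrib]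
      simp
      ring
    rw [hdec]
    calc _ ≤ ‖(w 0 : ℂ) * ∑ k ∈ range (K + 1 + 1), x k‖ + _ := norm_add_le _ _
      _ ≤ w 0 * (α * (K + 1 + 1 : ℕ) + β) + (α * ∑ k ∈ range (K + 1), (w (k + 1) - w 0)
          + β * (w (K + 1) - w 0)) := by
          rw [norm_mul, Complex.norm_real, Real.norm_of_nonneg h0]
          gcongr
      _ = _ := by rw [hsum]; push_cast; ring

/-! ### Taylor polynomials at 0 and their remainders -/

/-- The Taylor polynomial at `0` of degree at most `J`, evaluated at `z`. -/
noncomputable def taylorAtZero (J : ℕ) (f : ℂ → ℂ) (z : ℂ) : ℂ :=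
  ∑ j ∈ Finset.range (J + 1), iteratedDeriv j f 0 / (j.factorial : ℂ) * z ^ j

theorem taylorAtZero_add (J : ℕ) {f g : ℂ → ℂ} (hf : AnalyticAt ℂ f 0) (hg : AnalyticAt ℂ g 0)
    (z : ℂ) : taylorAtZero J (fun z => f z + g z) z = taylorAtZero J f z + taylorAtZero J g z := by
  simp only [taylorAtZero, ← Finset.sum_add_distrib]
  refine Finset.sum_congr rfl fun j _ => ?_
  rw [iteratedDeriv_fun_add hf.contDiffAt hg.contDiffAt]
  ring

theorem taylorAtZero_const_mul_pow {J q : ℕ} (hq : q ≤ J) (a z : ℂ) :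
    taylorAtZero J (fun z => a * z ^ q) z = a * z ^ q := by
  rw [taylorAtZero, Finset.sum_eq_single q]
  · rw [iteratedDeriv_const_mul_field, iteratedDeriv_fun_pow_zero, if_pos rfl]
    have : (q.factorial : ℂ) ≠ 0 := Nat.cast_ne_zero.2 q.factorial_ne_zero
    field_simp
  · intro j _ hj
    rw [iteratedDeriv_const_mul_field, iteratedDeriv_fun_pow_zero, if_neg hj]
    simp
  · intro h
    exact absurd (Finset.mem_range.2 (by omega)) h

/-- The condition on n says that the top exponent 3(n - 1) does not exceed J. -/
theorem taylorAtZero_sum_cube {J n : ℕ} (hn : 3 * n ≤ J + 3) (a : ℕ → ℂ) (z : ℂ) :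
    taylorAtZero J (fun z => ∑ m ∈ Finset.range n, a m * z ^ (3 * m)) z
      = ∑ m ∈ Finset.range n, a m * z ^ (3 * m) := by
  induction n with
  | zero => simp [taylorAtZero]
  | succ n ih =>
    simp only [Finset.sum_range_succ]
    rw [taylorAtZero_add J (by fun_prop) (by fun_prop), ih (by omega),
      taylorAtZero_const_mul_pow (by omega)]

theorem taylorAtZero_eq_zero_of_order {J : ℕ} {f : ℂ → ℂ} (hf : AnalyticAt ℂ f 0)
    (h : ((J + 1 : ℕ) : ℕ∞) ≤ analyticOrderAt f 0) (z : ℂ) : taylorAtZero J f z = 0 := by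
  rw [natCast_le_analyticOrderAt_iff_iteratedDeriv_eq_zero hf] at h
  exact Finset.sum_eq_zero fun j hj => by rw [h j (Finset.mem_range.1 hj)]; simp

theorem le_analyticOrderAt_exp_sub (n : ℕ) :
    (n : ℕ∞) ≤ analyticOrderAt
      (fun w : ℂ => Complex.exp w - ∑ m ∈ Finset.range n, w ^ m / (m.factorial : ℂ)) 0 := by
  rw [natCast_le_analyticOrderAt_iff_iteratedDeriv_eq_zero (by fun_prop)]
  intro i hi
  rw [iteratedDeriv_fun_sub (by fun_prop) (by fun_prop), iteratedDeriv_fun_sum (by fun_prop),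
    Finset.sum_eq_single i]
  · rw [iteratedDeriv_div_const, iteratedDeriv_fun_pow_zero, if_pos rfl,
      div_self (Nat.cast_ne_zero.2 i.factorial_ne_zero)]
    rw [iteratedDeriv_eq_iterate, Complex.iter_deriv_exp, Complex.exp_zero, sub_self]
  · intro j _ hj
    rw [iteratedDeriv_div_const, iteratedDeriv_fun_pow_zero, if_neg (Ne.symm hj)]
    simp
  · intro h
    exact absurd (Finset.mem_range.2 hi) h

/-- The exponential tail is w^n times an analytic function, and substituting w = cz³ triples the
order of vanishing. -/
theorem le_analyticOrderAt_exp_cube_sub (n : ℕ) (c : ℂ) :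
    ((3 * n : ℕ) : ℕ∞) ≤ analyticOrderAt (fun z : ℂ => Complex.exp (c * z ^ 3)
      - ∑ m ∈ Finset.range n, (c * z ^ 3) ^ m / (m.factorial : ℂ)) 0 := by
  obtain ⟨g, hg, hgeq⟩ := (natCast_le_analyticOrderAt (by fun_prop)).1
    (le_analyticOrderAt_exp_sub n)
  rw [natCast_le_analyticOrderAt (by fun_prop)]
  have h0 : c * (0 : ℂ) ^ 3 = 0 := by simp
  have ht : Filter.Tendsto (fun z : ℂ => c * z ^ 3) (nhds 0) (nhds 0) := by
    have : Continuous fun z : ℂ => c * z ^ 3 := by fun_prop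
    simpa using this.tendsto 0
  refine ⟨fun z => c ^ n * g (c * z ^ 3), ?_, ?_⟩
  · have : AnalyticAt ℂ (fun z => g (c * z ^ 3)) 0 :=
      AnalyticAt.fun_comp (f := fun z : ℂ => c * z ^ 3) (g := g) (by rw [h0]; exact hg)
        (by fun_prop)
    exact analyticAt_const.mul this
  · filter_upwards [ht.eventually hgeq] with z hz
    rw [hz]
    simp only [sub_zero, smul_eq_mul]
    ring

/-- Cauchy's estimates on |z| = R bound the j-th Taylor term by M q^j; the tail is a geometric
series. -/
theorem norm_sub_taylorAtZero_le {f : ℂ → ℂ} (hf : DifferentiableOn ℂ f (Metric.ball 0 1))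
    {R M q : ℝ} (hR : 0 < R) (hR1 : R < 1) (hM : ∀ z : ℂ, ‖z‖ = R → ‖f z‖ ≤ M) (hM0 : 0 ≤ M)
    (hq1 : q < 1) {z : ℂ} (hz : ‖z‖ ≤ q * R) (J : ℕ) :
    ‖f z - taylorAtZero J f z‖ ≤ M * q ^ (J + 1) / (1 - q) := by
  have hq0 : 0 ≤ q := by
    by_contra h
    nlinarith [norm_nonneg z]
  have hz1 : z ∈ Metric.ball (0 : ℂ) 1 := by
    rw [mem_ball_zero_iff]; nlinarith
  have hs := Complex.hasSum_taylorSeries_on_ball hf hz1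
  have hs' : HasSum (fun j : ℕ => iteratedDeriv j f 0 / (j.factorial : ℂ) * z ^ j) (f z) := by
    have e : (fun j : ℕ => iteratedDeriv j f 0 / (j.factorial : ℂ) * z ^ j)
        = fun n : ℕ => (n.factorial : ℂ)⁻¹ • (z - 0) ^ n • iteratedDeriv n f 0 := by
      funext j
      simp only [sub_zero, smul_eq_mul]
      ring
    rw [e]
    exact hs
  have htail := (hasSum_nat_add_iff' (J + 1)).2 hs'
  have hcoef : ∀ j, ‖iteratedDeriv j f 0 / (j.factorial : ℂ) * z ^ j‖ ≤ M * q ^ j := by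
    intro j
    have hd : DiffContOnCl ℂ f (Metric.ball 0 R) :=
      (hf.mono (by
        rw [closure_ball _ hR.ne']
        exact Metric.closedBall_subset_ball hR1)).diffContOnCl
    have hb := Complex.norm_iteratedDeriv_le_of_forall_mem_sphere_norm_le j hR hd
      (C := M) (fun z hz => hM z (by simpa using hz))
    have hfac : (0 : ℝ) < j.factorial := by exact_mod_cast j.factorial_pos
    rw [norm_mul, norm_div, norm_pow, Complex.norm_natCast]
    calc _ ≤ (j.factorial * M / R ^ j) / j.factorial * (q * R) ^ j := by gcongr
      _ = M * q ^ j := by rw [mul_pow]; field_simp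
  have hgeo : HasSum (fun j : ℕ => M * q ^ (j + (J + 1))) (M * q ^ (J + 1) / (1 - q)) := by
    have := (hasSum_geometric_of_lt_one hq0 hq1).mul_left (M * q ^ (J + 1))
    have e : (fun j : ℕ => M * q ^ (j + (J + 1))) = fun j => M * q ^ (J + 1) * q ^ j := by
      funext j
      rw [pow_add]; ring
    rw [e, div_eq_mul_inv]
    exact this
  exact htail.norm_le_of_bounded hgeo fun j => hcoef _

/-! ### Comparison of `fTaylor` with the cubic exponential -/

namespace RSTruncation

theorem fTaylor_eq_exp (t : ℝ) {z : ℂ} (hz : ‖z‖ < 1) :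
    fTaylor (1 / 2 - Complex.I * (t : ℂ)) z =
      Complex.exp (Complex.I * t * (Complex.log (1 + z) - z + z ^ 2 / 2)
        - Complex.log (1 + z) / 2) := by
  have hne : 1 + z ≠ 0 := Complex.slitPlane_ne_zero (Complex.mem_slitPlane_of_norm_lt_one hz)
  rw [fTaylor, Complex.cpow_def_of_ne_zero hne, ← Complex.exp_sub]
  congr 1
  ring

theorem differentiableOn_fTaylor (s : ℂ) :
    DifferentiableOn ℂ (fTaylor s) (Metric.ball 0 1) := by
  intro z hz
  have hs : 1 + z ∈ Complex.slitPlane :=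
    Complex.mem_slitPlane_of_norm_lt_one (by simpa using hz)
  have hne : 1 + z ≠ 0 := Complex.slitPlane_ne_zero hs
  refine DifferentiableAt.differentiableWithinAt ?_
  unfold fTaylor
  refine DifferentiableAt.div (by fun_prop) ?_ ?_
  · exact DifferentiableAt.cpow (by fun_prop) (by fun_prop) hs
  · rw [Complex.cpow_def_of_ne_zero hne]; exact Complex.exp_ne_zero _

/-- The quotient of the two functions is e^w, where w collects the terms of it·log(1+z) beyond the
cubic one and -log(1+z)/2. Here |w| ≤ W ≤ 1, so |e^w - 1| ≤ 2W. -/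
theorem norm_fTaylor_sub_exp_cube_le {t R : ℝ} (ht : 0 < t) (hR : R < 1)
    {z : ℂ} (hz : ‖z‖ = R) {W : ℝ} (hW1 : W ≤ 1)
    (hW : R / (1 - R) / 2 + t * (R ^ 4 / (1 - R) / 4) ≤ W) :
    ‖fTaylor (1 / 2 - Complex.I * (t : ℂ)) z - Complex.exp (Complex.I * t / 3 * z ^ 3)‖
      ≤ Real.exp (t * R ^ 3 / 3) * (2 * W) := by
  have hz1 : ‖z‖ < 1 := hz ▸ hR
  set w : ℂ := Complex.I * t * (Complex.log (1 + z) - Complex.logTaylor 4 z)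
    - Complex.log (1 + z) / 2 with hw
  have hT : Complex.logTaylor 4 z = z - z ^ 2 / 2 + z ^ 3 / 3 := by
    simp [Complex.logTaylor, Finset.sum_range_succ]
    ring
  have hfac : fTaylor (1 / 2 - Complex.I * (t : ℂ)) z
      = Complex.exp (Complex.I * t / 3 * z ^ 3) * Complex.exp w := by
    rw [fTaylor_eq_exp t hz1, ← Complex.exp_add, hw, hT]
    congr 1
    ring
  have h4 := Complex.norm_log_sub_logTaylor_le 3 hz1
  have h1 := Complex.norm_log_sub_logTaylor_le 0 hz1
  have hT1 : Complex.logTaylor (0 + 1) z = 0 := by simp [Complex.logTaylor]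
  rw [hT1, sub_zero, hz] at h1
  rw [hz] at h4
  norm_num at h4 h1
  have hwW : ‖w‖ ≤ W := by
    refine le_trans ?_ hW
    calc ‖w‖ ≤ ‖Complex.I * t * (Complex.log (1 + z) - Complex.logTaylor 4 z)‖
          + ‖Complex.log (1 + z) / 2‖ := norm_sub_le _ _
      _ = t * ‖Complex.log (1 + z) - Complex.logTaylor 4 z‖ + ‖Complex.log (1 + z)‖ / 2 := by
          simp [abs_of_pos ht]
      _ ≤ t * (R ^ 4 * (1 - R)⁻¹ / 4) + (R * (1 - R)⁻¹) / 2 := by gcongr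
      _ = _ := by rw [div_eq_mul_inv R, div_eq_mul_inv (R ^ 4)]; ring
  rw [hfac, ← mul_sub_one, norm_mul]
  gcongr
  · rw [Complex.norm_exp]
    refine Real.exp_le_exp.2 ((Complex.re_le_norm _).trans (le_of_eq ?_))
    simp [hz, abs_of_pos ht]
    ring
  · exact (Complex.norm_exp_sub_one_le (hwW.trans hW1)).trans (by linarith)

/-- With E the cubic exponential and P its series cut before the n-th term, f = P + (E - P) + (f -
E). The degree-J Taylor polynomial reproduces P and kills E - P, which vanishes to order 3n > J. The
first error term is the exponential tail beyond n, the second the Taylor remainder of f - E. -/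
theorem norm_fTaylor_sub_taylor_sub_le {t u x : ℝ} (ht : 0 < t) (hu : 10 ^ 8 ≤ u)
    (htu : t ≤ 0.729 * u ^ 3) (hx0 : 0 ≤ x) (hx : x ≤ 1 / u) {J n : ℕ} (hJ : J + 3 = 3 * n) :
    ‖fTaylor (1 / 2 - Complex.I * (t : ℂ)) x
        - taylorAtZero J (fTaylor (1 / 2 - Complex.I * (t : ℂ))) x
        - (Complex.I * t / 3 * x ^ 3) ^ n / (n.factorial : ℂ)‖
      ≤ (t * x ^ 3 / 3) ^ (n + 1) * ((n + 2) / ((n + 1).factorial * (n + 1)))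
        + 0.000561 * (1 / 3) ^ (J + 1) := by
  have hu0 : 0 < u := by linarith
  set c : ℂ := Complex.I * t / 3 with hc
  set f := fTaylor (1 / 2 - Complex.I * (t : ℂ)) with hf
  set E : ℂ → ℂ := fun z => Complex.exp (c * z ^ 3) with hE
  set P : ℂ → ℂ := fun z => ∑ m ∈ Finset.range n, (c * z ^ 3) ^ m / (m.factorial : ℂ) with hP
  have hfd : DifferentiableOn ℂ f (Metric.ball 0 1) := differentiableOn_fTaylor _
  have hfa : AnalyticAt ℂ f 0 := hfd.analyticAt (Metric.ball_mem_nhds _ one_pos)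
  have hEa : AnalyticAt ℂ E 0 := by fun_prop
  have hPa : AnalyticAt ℂ P 0 := by fun_prop
  have hdec : f = fun z => (P z + (E z - P z)) + (f z - E z) := by
    funext z; ring
  have hT : taylorAtZero J f x = P x + taylorAtZero J (fun z => f z - E z) x := by
    conv_lhs => rw [hdec]
    rw [taylorAtZero_add J (by fun_prop) (by fun_prop), taylorAtZero_add J hPa (by fun_prop),
      taylorAtZero_eq_zero_of_order (f := fun z => E z - P z) (by fun_prop) ?_, add_zero]
    · congr 1
      have : P = fun z => ∑ m ∈ Finset.range n, (c ^ m / (m.factorial : ℂ)) * z ^ (3 * m) := by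
        funext z
        exact Finset.sum_congr rfl fun m _ => by rw [mul_pow, pow_mul]; ring
      rw [this]
      exact taylorAtZero_sum_cube (by omega) _ _
    · refine le_trans ?_ (le_analyticOrderAt_exp_cube_sub n c)
      exact_mod_cast (by omega : J + 1 ≤ 3 * n)
  have huinv : 1 / u ≤ 1 / 10 ^ 8 := one_div_le_one_div_of_le (by norm_num) hu
  have hx1 : t * x ^ 3 / 3 ≤ 1 := by
    have : t * x ^ 3 ≤ (0.729 * u ^ 3) * (1 / u) ^ 3 := by gcongr
    have e : (0.729 * u ^ 3) * (1 / u) ^ 3 = 0.729 := by field_simp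
    linarith
  have hnorm : ‖c * (x : ℂ) ^ 3‖ = t * x ^ 3 / 3 := by
    rw [hc]
    simp [abs_of_pos ht, abs_of_nonneg hx0]
    ring
  have hexp := Complex.exp_bound (x := c * (x : ℂ) ^ 3) (by rw [hnorm]; exact hx1)
    (n := n + 1) (by omega)
  rw [hnorm, Finset.sum_range_succ, ← sub_sub] at hexp
  -- Cauchy's estimates are used on the radius 3/u, three times the largest x, hence the ratio 1/3.
  -- There t|z|³/3 ≤ 6.561 < 7, so |E| ≤ e^7 < 1100, and |f - E| ≤ 1100·2·17/10^8; the factor 1/(1 -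
  -- 1/3) turns this into 0.000561.
  have hrem : ‖(f x - E x) - taylorAtZero J (fun z => f z - E z) x‖
      ≤ 0.000561 * (1 / 3) ^ (J + 1) := by
    have hR : 3 / u ≤ 3 / 10 ^ 8 := by gcongr
    have hR0 : 0 < 3 / u := by positivity
    have ht3 : t * (3 / u) ^ 3 ≤ 0.729 * 27 := by
      calc t * (3 / u) ^ 3 ≤ (0.729 * u ^ 3) * (3 / u) ^ 3 := by gcongr
        _ = 0.729 * 27 := by field_simp; norm_num
    have hone : (1 - 3 / u)⁻¹ ≤ 1.001 := by
      rw [inv_le_comm₀ (by linarith) (by norm_num)]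
      norm_num at hR ⊢; linarith
    have hW : (3 / u) / (1 - 3 / u) / 2 + t * ((3 / u) ^ 4 / (1 - 3 / u) / 4) ≤ 17 / u := by
      have hi : 0 ≤ (1 - 3 / u)⁻¹ := by
        rw [inv_nonneg]; linarith
      have e : (3 / u) / (1 - 3 / u) / 2 + t * ((3 / u) ^ 4 / (1 - 3 / u) / 4)
          = (1 / u) * (1 - 3 / u)⁻¹ * (3 / 2 + t * (3 / u) ^ 3 * (3 / 4)) := by
        rw [div_eq_mul_inv (3 / u), div_eq_mul_inv ((3 / u) ^ 4)]
        ring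
      rw [e]
      calc _ ≤ (1 / u) * 1.001 * (3 / 2 + 0.729 * 27 * (3 / 4)) := by gcongr
        _ = (1 / u) * (1.001 * (3 / 2 + 0.729 * 27 * (3 / 4))) := by ring
        _ ≤ (1 / u) * 17 := by gcongr; norm_num
        _ = 17 / u := by ring
    have hexpR : Real.exp (t * (3 / u) ^ 3 / 3) ≤ 1100 := by
      calc Real.exp (t * (3 / u) ^ 3 / 3) ≤ Real.exp ((7 : ℕ) * 1) := by
            apply Real.exp_le_exp.2; norm_num at ht3 ⊢; linarith
        _ = Real.exp 1 ^ 7 := by rw [Real.exp_nat_mul]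
        _ ≤ 2.7182818286 ^ 7 := by gcongr; exact Real.exp_one_lt_d9.le
        _ ≤ 1100 := by norm_num
    have hM : ∀ z : ℂ, ‖z‖ = 3 / u → ‖(fun z => f z - E z) z‖ ≤ 37400 / 10 ^ 8 := by
      intro z hz
      refine (norm_fTaylor_sub_exp_cube_le ht (by linarith) hz (W := 17 / u) ?_ hW).trans ?_
      · rw [div_le_one hu0]; linarith
      · calc _ ≤ (1100 : ℝ) * (2 * (17 / 10 ^ 8)) := by gcongr
          _ = 37400 / 10 ^ 8 := by norm_num
    have hEd : DifferentiableOn ℂ E (Metric.ball 0 1) := by fun_prop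
    refine (norm_sub_taylorAtZero_le (hfd.sub hEd) hR0 (by linarith) hM (by norm_num)
      (q := 1 / 3) (by norm_num) ?_ J).trans ?_
    · rw [Complex.norm_real, Real.norm_of_nonneg hx0]
      refine hx.trans (le_of_eq ?_)
      field_simp
    · have e : (37400 / 10 ^ 8 : ℝ) * (1 / 3) ^ (J + 1) / (1 - 1 / 3)
          = 0.000561 * (1 / 3) ^ (J + 1) := by ring
      exact e.le
  have hsplit : f x - taylorAtZero J f x - (c * (x : ℂ) ^ 3) ^ n / (n.factorial : ℂ)
      = (Complex.exp (c * (x : ℂ) ^ 3) - P x - (c * (x : ℂ) ^ 3) ^ n / (n.factorial : ℂ))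
        + ((f x - E x) - taylorAtZero J (fun z => f z - E z) x) := by
    rw [hT]; simp only [hE]; ring
  rw [hsplit]
  refine (norm_add_le _ _).trans (add_le_add (hexp.trans (le_of_eq ?_)) hrem)
  rw [Nat.succ_eq_add_one, div_eq_mul_inv]
  push_cast
  ring

end RSTruncation

/-! ### Convexity of x^{-1/4}, telescoping and power sums -/

theorem convexOn_exp_neg_log_div_four :
    ConvexOn ℝ (Set.Ioi 0) fun x : ℝ => Real.exp (-(Real.log x / 4)) := by
  refine ⟨convex_Ioi 0, fun x hx y hy a b ha hb hab => ?_⟩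
  have hlog := strictConcaveOn_log_Ioi.concaveOn.2 hx hy ha hb hab
  have hexp := convexOn_exp.2 (Set.mem_univ (-(Real.log x / 4))) (Set.mem_univ (-(Real.log y / 4)))
    ha hb hab
  simp only [smul_eq_mul] at hlog hexp ⊢
  refine le_trans (Real.exp_le_exp.2 ?_) hexp
  linarith

/-- By convexity the secant over [q - 1, q] is steeper than those over [q - 1/20, q] and [q, q +
1/40], and 1/20 + 1/40 = 3/40. -/
theorem exp_neg_log_div_four_sub_le {q : ℝ} (hq : 2 ≤ q) :
    Real.exp (-(Real.log (q - 1 / 20) / 4)) - Real.exp (-(Real.log (q + 1 / 40) / 4))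
      ≤ 3 / 40 * (Real.exp (-(Real.log (q - 1) / 4)) - Real.exp (-(Real.log q / 4))) := by
  have hc := convexOn_exp_neg_log_div_four
  set g : ℝ → ℝ := fun x => Real.exp (-(Real.log x / 4)) with hg
  have m : ∀ {x : ℝ}, q - 1 ≤ x → x ∈ Set.Ioi (0 : ℝ) := fun {x} hx => by
    simp only [Set.mem_Ioi]; linarith
  have s1 := hc.secant_mono (a := q) (x := q - 1) (y := q + 1 / 40) (m (by linarith))
    (m (by linarith)) (m (by linarith)) (by linarith) (by linarith) (by linarith)
  have s2 := hc.secant_mono (a := q + 1 / 40) (x := q - 1 / 20) (y := q) (m (by linarith))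
    (m (by linarith)) (m (by linarith)) (by linarith) (by linarith) (by linarith)
  have s3 := hc.secant_mono (a := q) (x := q - 1) (y := q - 1 / 20) (m (by linarith))
    (m (by linarith)) (m (by linarith)) (by linarith) (by linarith) (by linarith)
  change (g (q - 1) - g q) / (q - 1 - q) ≤ (g (q + 1 / 40) - g q) / (q + 1 / 40 - q) at s1
  change (g (q - 1) - g q) / (q - 1 - q) ≤ (g (q - 1 / 20) - g q) / (q - 1 / 20 - q) at s3
  change g (q - 1 / 20) - g (q + 1 / 40) ≤ 3 / 40 * (g (q - 1) - g q)
  rw [show q - 1 - q = -1 by ring, show q + 1 / 40 - q = 1 / 40 by ring] at s1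
  rw [show q - 1 - q = -1 by ring, show q - 1 / 20 - q = -(1 / 20) by ring] at s3
  have e3 : (g (q - 1 / 20) - g q) / (-(1 / 20)) = -20 * (g (q - 1 / 20) - g q) := by ring
  have e1 : (g (q + 1 / 40) - g q) / (1 / 40) = 40 * (g (q + 1 / 40) - g q) := by ring
  rw [e1] at s1
  rw [e3] at s3
  linarith

-- The increments that S skips are nonnegative, so S may be filled up to an interval, over which the
-- sum telescopes.
open Finset in
theorem sum_increments_le {G : ℕ → ℝ} (hG : Monotone G) (S : Finset ℕ) {a b : ℝ} (hab : a ≤ b)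
    (ha : ∀ r ∈ S, a ≤ G r) (hb : ∀ r ∈ S, G (r + 1) ≤ b) :
    ∑ r ∈ S, (G (r + 1) - G r) ≤ b - a := by
  rcases S.eq_empty_or_nonempty with rfl | hS
  · simpa using hab
  have hsub : S ⊆ Ico (S.min' hS) (S.max' hS + 1) := fun r hr =>
    mem_Ico.2 ⟨S.min'_le r hr, Nat.lt_succ_of_le (S.le_max' r hr)⟩
  calc _ ≤ ∑ r ∈ Ico (S.min' hS) (S.max' hS + 1), (G (r + 1) - G r) :=
        sum_le_sum_of_subset_of_nonneg hsub fun r _ _ => sub_nonneg.2 (hG (Nat.le_succ r))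
    _ = G (S.max' hS + 1) - G (S.min' hS) :=
        sum_Ico_sub _ ((S.min'_le_max' hS).trans (Nat.le_succ _))
    _ ≤ b - a := sub_le_sub (hb _ (S.max'_mem hS)) (ha _ (S.min'_mem hS))

theorem sum_range_pow_le (K p : ℕ) :
    ∑ k ∈ Finset.range K, (k : ℝ) ^ p ≤ (K : ℝ) ^ (p + 1) / (p + 1) := by
  have hp : (0 : ℝ) < p + 1 := by positivity
  rw [le_div_iff₀ hp]
  induction K with
  | zero => simp
  | succ K ih =>
    rw [Finset.sum_range_succ, add_mul]
    have hpow : ∀ m : ℕ, (K : ℝ) ^ m + m * (K : ℝ) ^ (m - 1) ≤ ((K : ℝ) + 1) ^ m := by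
      intro m
      induction m with
      | zero => simp
      | succ m ihm =>
        have hK : (0 : ℝ) ≤ K := by positivity
        have h1 : (m : ℝ) * (K : ℝ) ^ (m - 1) * K = m * (K : ℝ) ^ m := by
          rcases m with _ | m
          · simp
          · simp [pow_succ]; ring
        have h2 : (0 : ℝ) ≤ m * (K : ℝ) ^ (m - 1) := by positivity
        calc (K : ℝ) ^ (m + 1) + (m + 1 : ℕ) * (K : ℝ) ^ (m + 1 - 1)
            = K ^ m * K + (m * K ^ (m - 1) * K + K ^ m) := by
              rw [h1, Nat.add_sub_cancel]; push_cast; ring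
          _ ≤ (K ^ m + m * K ^ (m - 1)) * (K + 1) := by linarith
          _ ≤ ((K : ℝ) + 1) ^ m * (K + 1) := by gcongr
          _ = _ := by ring
    have := hpow (p + 1)
    rw [Nat.add_sub_cancel] at this
    push_cast at this ⊢
    linarith

open Finset in
theorem sum_Ico_eq_sum_blocks {M : Type*} [AddCommMonoid M] (v : ℕ → ℕ) (hv : Monotone v)
    (F : ℕ → M) (n : ℕ) :
    ∑ i ∈ Ico (v 0) (v n), F i = ∑ r ∈ range n, ∑ k ∈ range (v (r + 1) - v r), F (v r + k) := by
  induction n with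
  | zero => simp
  | succ n ih =>
    rw [sum_range_succ, ← ih, ← sum_Ico_consecutive F (hv n.zero_le) (hv n.le_succ),
      sum_Ico_eq_sum_range F (v n)]

/-! ### Decomposition of the main sum into blocks -/

namespace RSTruncation

theorem blockStart_mono (u : ℝ) (v₀ : ℕ) : Monotone (blockStart u v₀) :=
  monotone_nat_of_le_succ fun r => by rw [blockStart]; omega

theorem le_blockStart (u : ℝ) (v₀ r : ℕ) : v₀ ≤ blockStart u v₀ r :=
  blockStart_mono u v₀ r.zero_le

theorem add_le_blockStart {u : ℝ} (hu : 0 < u) {v₀ : ℕ} (hv : 0 < v₀) (r : ℕ) :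
    v₀ + r ≤ blockStart u v₀ r := by
  induction r with
  | zero => simp [blockStart]
  | succ r ih =>
    rw [blockStart]
    have : 0 < ⌈(blockStart u v₀ r : ℝ) / u⌉₊ := by
      rw [Nat.ceil_pos]
      have : (0 : ℝ) < blockStart u v₀ r := by exact_mod_cast (by omega : 0 < blockStart u v₀ r)
      positivity
    omega

theorem lastBlock_spec {t u : ℝ} (hu : 0 < u) {v₀ : ℕ} (hv : 0 < v₀) (hN : v₀ ≤ mainLength t) :
    blockStart u v₀ (lastBlock t u v₀) ≤ mainLength t ∧
      mainLength t < blockStart u v₀ (lastBlock t u v₀ + 1) := by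
  set S := {r : ℕ | blockStart u v₀ r < mainLength t + 1} with hS
  have hbdd : BddAbove S := ⟨mainLength t, fun r hr => by
    have := add_le_blockStart hu hv r
    have hr' : blockStart u v₀ r < mainLength t + 1 := hr
    omega⟩
  have hne : S.Nonempty := ⟨0, by
    change v₀ < mainLength t + 1
    omega⟩
  have hlast : lastBlock t u v₀ = sSup S := rfl
  constructor
  · have : lastBlock t u v₀ ∈ S := hlast ▸ Nat.sSup_mem hne hbdd
    exact Nat.lt_succ_iff.1 this
  · by_contra h
    have hmem : lastBlock t u v₀ + 1 ∈ S := by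
      change blockStart u v₀ (lastBlock t u v₀ + 1) < mainLength t + 1
      omega
    have := le_csSup hbdd hmem
    omega

theorem sum_Ico_eq_sum_blockLength {t u : ℝ} (hu : 0 < u) {v₀ : ℕ} (hv : 0 < v₀)
    (hN : v₀ ≤ mainLength t) (F : ℕ → ℂ) :
    ∑ n ∈ Finset.Ico v₀ (mainLength t + 1), F n =
      ∑ r ∈ Finset.range (lastBlock t u v₀ + 1), ∑ k ∈ Finset.range (blockLength t u v₀ r),
        F (blockStart u v₀ r + k) := by
  obtain ⟨h1, h2⟩ := lastBlock_spec (t := t) hu hv hN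
  -- The next start passes N, so the minimum defining the last length is N + 1 - v_R: the blocks end
  -- exactly at N.
  have hlast : blockLength t u v₀ (lastBlock t u v₀)
      = mainLength t + 1 - blockStart u v₀ (lastBlock t u v₀) := by
    rw [blockLength, if_neg (lt_irrefl _)]
    rw [blockStart] at h2
    omega
  have hsum := sum_Ico_eq_sum_blocks (blockStart u v₀) (blockStart_mono u v₀) F (lastBlock t u v₀)
  rw [Finset.sum_range_succ, hlast, ← Finset.sum_Ico_consecutive F (le_blockStart u v₀ _)
    (Nat.le_succ_of_le h1), Finset.sum_Ico_eq_sum_range F (blockStart u v₀ (lastBlock t u v₀))]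
  congr 1
  refine hsum.trans (Finset.sum_congr rfl fun r hr => ?_)
  rw [blockLength, if_pos (Finset.mem_range.1 hr), blockStart, Nat.add_sub_cancel_left]

theorem blockLength_le (t u : ℝ) (v₀ r : ℕ) :
    blockLength t u v₀ r ≤ ⌈(blockStart u v₀ r : ℝ) / u⌉₊ := by
  rw [blockLength]
  split_ifs
  · exact le_rfl
  · exact min_le_left _ _

theorem blockLength_pos {t u : ℝ} (hu : 0 < u) {v₀ : ℕ} (hv : 0 < v₀) (hN : v₀ ≤ mainLength t)
    {r : ℕ} (hr : r ≤ lastBlock t u v₀) : 0 < blockLength t u v₀ r := by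
  have hr1 : blockStart u v₀ r ≤ mainLength t :=
    (blockStart_mono u v₀ hr).trans (lastBlock_spec hu hv hN).1
  have hp : 0 < ⌈(blockStart u v₀ r : ℝ) / u⌉₊ := by
    rw [Nat.ceil_pos]
    have : (0 : ℝ) < blockStart u v₀ r := by exact_mod_cast hv.trans_le (le_blockStart u v₀ r)
    positivity
  rw [blockLength]
  split_ifs
  · exact hp
  · omega

/-- Splitting log(1 + x) as x - x²/2 plus a remainder: the first part is the quadratic phase, and
the remainder together with (1 + x)^{-1/2} is `fTaylor`. -/
theorem term_add (t : ℝ) {v : ℕ} (hv : 0 < v) (k : ℕ) (hk : (k : ℝ) / v < 1) :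
    term t (v + k) = term t v * (quadPhase (t / (2 * Real.pi * v)) (-(t / (4 * Real.pi * v ^ 2))) k
      * fTaylor (1 / 2 - Complex.I * (t : ℂ)) ((k / v : ℝ) : ℂ)) := by
  have hv' : (0 : ℝ) < v := by exact_mod_cast hv
  set x : ℝ := k / v with hx
  have hx0 : 0 ≤ x := by positivity
  have h1x : 0 < 1 + x := by linarith
  have hvk : ((v + k : ℕ) : ℝ) = v * (1 + x) := by rw [hx]; push_cast; field_simp
  have hsqrt : ((Real.sqrt (1 + x) : ℝ) : ℂ) = Complex.exp (Complex.log (1 + (x : ℂ)) / 2) := by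
    rw [Real.sqrt_eq_rpow, Real.rpow_def_of_pos h1x]
    push_cast
    rw [Complex.ofReal_log h1x.le]
    push_cast
    ring_nf
  rw [fTaylor_eq_exp t (by rw [Complex.norm_real, Real.norm_of_nonneg hx0]; exact hk), term, term,
    hvk, Real.log_mul hv'.ne' h1x.ne', Real.sqrt_mul hv'.le, Complex.ofReal_mul, hsqrt,
    Complex.ofReal_add, Complex.ofReal_log h1x.le, mul_add, Complex.exp_add, Complex.exp_sub]
  have hpi : (Real.pi : ℂ) ≠ 0 := Complex.ofReal_ne_zero.2 Real.pi_ne_zero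
  have hvC : (v : ℂ) ≠ 0 := by exact_mod_cast hv.ne'
  have hphase : quadPhase (t / (2 * Real.pi * v)) (-(t / (4 * Real.pi * v ^ 2))) k
      = Complex.exp (Complex.I * t * (x - x ^ 2 / 2)) := by
    rw [quadPhase, hx]
    congr 1
    push_cast
    field_simp
    ring
  have hsplit : Complex.exp (Complex.I * t * (Complex.log (1 + (x : ℂ)) - x + x ^ 2 / 2))
      * Complex.exp (Complex.I * t * (x - x ^ 2 / 2))
      = Complex.exp (Complex.I * t * Complex.log (1 + (x : ℂ))) := by
    rw [← Complex.exp_add]; congr 1; ring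
  have hs : ((Real.sqrt v : ℝ) : ℂ) ≠ 0 := Complex.ofReal_ne_zero.2 (Real.sqrt_pos.2 hv').ne'
  have he := Complex.exp_ne_zero (Complex.log (1 + (x : ℂ)) / 2)
  rw [hphase, Complex.ofReal_add, Complex.ofReal_one, ← hsplit]
  field_simp

theorem truncBlock_eq_sum {t u : ℝ} {v₀ : ℕ} (hv : 0 < v₀) (J r : ℕ)
    (hK : 0 < blockLength t u v₀ r) :
    truncBlock J t u v₀ r = ∑ k ∈ Finset.range (blockLength t u v₀ r),
      quadPhase (linArg t u v₀ r) (quadArg t u v₀ r) k *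
        taylorAtZero J (fTaylor (1 / 2 - Complex.I * (t : ℂ)))
          ((k / (blockStart u v₀ r : ℝ) : ℝ) : ℂ) := by
  simp only [truncBlock, taylorAtZero, Finset.mul_sum, coeff, quadSum]
  rw [Finset.sum_comm]
  refine Finset.sum_congr rfl fun k _ => Finset.sum_congr rfl fun j _ => ?_
  have hKC : (blockLength t u v₀ r : ℂ) ≠ 0 := by exact_mod_cast hK.ne'
  have hvC : (blockStart u v₀ r : ℂ) ≠ 0 := by
    exact_mod_cast (hv.trans_le (le_blockStart u v₀ r)).ne'
  change _ * (_ * (_ * quadPhase _ _ k)) = _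
  push_cast
  rw [div_pow, div_pow]
  field_simp

theorem norm_term (t : ℝ) (n : ℕ) : ‖term t n‖ = 1 / Real.sqrt n := by
  rw [term, norm_div, Complex.norm_real, Real.norm_of_nonneg (Real.sqrt_nonneg _),
    show Complex.I * (t : ℂ) * (Real.log (n : ℝ) : ℂ) = ((t * Real.log n : ℝ) : ℂ) * Complex.I by
      push_cast; ring, Complex.norm_exp_ofReal_mul_I]

theorem norm_truncError_le {t u : ℝ} (hu : 1 < u) {v₀ : ℕ} (hv : 0 < v₀) (hN : v₀ ≤ mainLength t)
    (J : ℕ) :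
    ‖truncError J t u v₀‖ ≤ ∑ r ∈ Finset.range (lastBlock t u v₀ + 1),
      1 / Real.sqrt (blockStart u v₀ r) *
        ‖∑ k ∈ Finset.range (blockLength t u v₀ r),
          (fTaylor (1 / 2 - Complex.I * (t : ℂ)) ((k / (blockStart u v₀ r : ℝ) : ℝ) : ℂ)
            - taylorAtZero J (fTaylor (1 / 2 - Complex.I * (t : ℂ)))
              ((k / (blockStart u v₀ r : ℝ) : ℝ) : ℂ)) *
          quadPhase (linArg t u v₀ r) (quadArg t u v₀ r) k‖ := by
  have hu0 : 0 < u := by linarith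
  have hmain : mainSum t - ∑ n ∈ Finset.Ico 1 v₀, term t n
      = ∑ n ∈ Finset.Ico v₀ (mainLength t + 1), term t n := by
    rw [mainSum, sub_eq_iff_eq_add', Finset.sum_Ico_consecutive _ hv (by omega)]
    rfl
  rw [truncError, hmain, sum_Ico_eq_sum_blockLength hu0 hv hN, ← Finset.sum_sub_distrib]
  refine (norm_sum_le _ _).trans (Finset.sum_le_sum fun r hr => ?_)
  have hK := blockLength_pos hu0 hv hN (Nat.lt_succ_iff.1 (Finset.mem_range.1 hr))
  have hvr : 0 < blockStart u v₀ r := hv.trans_le (le_blockStart u v₀ r)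
  have hvr' : (0 : ℝ) < blockStart u v₀ r := by exact_mod_cast hvr
  rw [truncBlock_eq_sum hv J r hK, ← norm_term t, ← norm_mul]
  refine le_of_eq (congrArg _ ?_)
  rw [Finset.mul_sum, Finset.mul_sum, ← Finset.sum_sub_distrib]
  refine Finset.sum_congr rfl fun k hk => ?_
  have hk' : (k : ℝ) < blockStart u v₀ r / u :=
    Nat.lt_ceil.1 ((Finset.mem_range.1 hk).trans_le (blockLength_le t u v₀ r))
  have hx : (k : ℝ) / blockStart u v₀ r < 1 := by
    rw [div_lt_one hvr']
    exact hk'.trans (div_lt_self hvr' hu)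
  rw [term_add t hvr k hx, linArg, quadArg]
  ring

end RSTruncation

/-! ### The error of a single block -/

namespace RSTruncation

/-- Rounding up adds at most 1 to a quantity that is at least 1799. -/
theorem ceil_div_bounds {u : ℝ} (hu : 0 < u) {v : ℕ} (hv : 1799 * u ≤ v) :
    (v : ℝ) / u ≤ ⌈(v : ℝ) / u⌉₊ ∧ (⌈(v : ℝ) / u⌉₊ : ℝ) ≤ v / u * (1800 / 1799) := by
  refine ⟨Nat.le_ceil _, ?_⟩
  have h1 := (Nat.ceil_lt_add_one (show (0 : ℝ) ≤ v / u by positivity)).le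
  have h2 : 1799 ≤ (v : ℝ) / u := by rwa [le_div_iff₀ hu]
  linarith

/-- With y the signed distance from U to the nearest integer, |e^{2πiy} - 1| = 2|sin πy| ≥ 4|y| ≥
1/10. -/
theorem le_norm_exp_sub_one {U b : ℝ} (hb : 8 * Real.pi * b = -(2 * Real.pi * U))
    (hU : 1 / 40 ≤ |U - round U|) :
    (0.1 : ℝ) ≤ ‖Complex.exp (((8 * Real.pi * b : ℝ) : ℂ) * Complex.I) - 1‖ := by
  set y := U - round U with hy
  have hexp : Complex.exp (((8 * Real.pi * b : ℝ) : ℂ) * Complex.I)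
      = Complex.exp (Complex.I * ((-(2 * Real.pi * y) : ℝ) : ℂ)) := by
    rw [hb, Complex.exp_eq_exp_iff_exists_int]
    refine ⟨-round U, ?_⟩
    rw [hy]
    push_cast
    ring
  have hpi := Real.pi_pos
  have hy2 : |y| ≤ 1 / 2 := abs_sub_round U
  rw [hexp, Complex.norm_exp_I_mul_ofReal_sub_one, norm_mul, Real.norm_eq_abs, Real.norm_eq_abs]
  have hs := Real.mul_abs_le_abs_sin (x := -(2 * Real.pi * y) / 2) (by
    rw [show -(2 * Real.pi * y) / 2 = -(Real.pi * y) by ring, abs_neg, abs_mul, abs_of_pos hpi]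
    nlinarith)
  have e : 2 / Real.pi * |-(2 * Real.pi * y) / 2| = 2 * |y| := by
    rw [show -(2 * Real.pi * y) / 2 = -(Real.pi * y) by ring, abs_neg, abs_mul, abs_of_pos hpi]
    field_simp
  rw [e] at hs
  rw [abs_of_pos (by norm_num : (0 : ℝ) < 2)]
  norm_num at hU ⊢
  linarith

/-- The power sum is compared with an integral. The constant is 0.729/3·(1800/1799)³, which bounds
tx³/3 when x is the full rounded block length over v. -/
theorem pow_mul_sum_cube_le {t u : ℝ} (ht : 0 < t) (hu : 0 < u) (htu : t ≤ 0.729 * u ^ 3) {v : ℕ}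
    (hv : 1799 * u ≤ v) {K : ℕ} (hK : K ≤ ⌈(v : ℝ) / u⌉₊) (m : ℕ) :
    (t / 3) ^ m * ∑ k ∈ Finset.range K, ((k : ℝ) / v) ^ (3 * m)
      ≤ ⌈(v : ℝ) / u⌉₊ * (0.24341 ^ m / (3 * m + 1)) := by
  set D := ⌈(v : ℝ) / u⌉₊ with hD
  have hv0 : (0 : ℝ) < v := by linarith
  have hD2 := (ceil_div_bounds hu hv).2
  rw [← hD] at hD2
  have hρ : (D : ℝ) / v ≤ 1 / u * (1800 / 1799) := by
    rw [div_le_iff₀ hv0]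
    calc (D : ℝ) ≤ v / u * (1800 / 1799) := hD2
      _ = _ := by ring
  have hθ : t / 3 * ((D : ℝ) / v) ^ 3 ≤ 0.24341 := by
    calc t / 3 * ((D : ℝ) / v) ^ 3
        ≤ (0.729 * u ^ 3) / 3 * (1 / u * (1800 / 1799)) ^ 3 := by gcongr
      _ = 0.729 / 3 * (1800 / 1799) ^ 3 := by field_simp
      _ ≤ 0.24341 := by norm_num
  have hsum : ∑ k ∈ Finset.range K, ((k : ℝ) / v) ^ (3 * m)
      ≤ (D : ℝ) ^ (3 * m + 1) / (3 * m + 1) / (v : ℝ) ^ (3 * m) := by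
    have hsub : Finset.range K ⊆ Finset.range D := Finset.range_subset_range.2 hK
    simp only [div_pow, ← Finset.sum_div]
    gcongr
    refine (Finset.sum_le_sum_of_subset_of_nonneg hsub fun _ _ _ => by positivity).trans ?_
    have := sum_range_pow_le D (3 * m)
    push_cast at this
    exact this
  calc _ ≤ (t / 3) ^ m * ((D : ℝ) ^ (3 * m + 1) / (3 * m + 1) / (v : ℝ) ^ (3 * m)) := by gcongr
    _ = D * ((t / 3 * ((D : ℝ) / v) ^ 3) ^ m / (3 * m + 1)) := by
        rw [mul_pow, ← pow_mul, div_pow (D : ℝ), pow_succ]; ring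
    _ ≤ _ := by gcongr

/-- The coefficient of the leading part of the truncation error of a block. -/
noncomputable def leadCoeff (n : ℕ) : ℝ := 0.24341 ^ n / (3 * n + 1) / n.factorial

/-- The coefficient of the remaining part of the truncation error of a block. -/
noncomputable def restCoeff (n : ℕ) : ℝ :=
  0.24341 ^ (n + 1) / (3 * n + 4) * ((n + 2) / ((n + 1).factorial * (n + 1)))
    + 0.000561 * (1 / 3) ^ (3 * n - 2)

theorem leadCoeff_nonneg (n : ℕ) : 0 ≤ leadCoeff n := by unfold leadCoeff; positivity

theorem restCoeff_nonneg (n : ℕ) : 0 ≤ restCoeff n := by unfold restCoeff; positivity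

/-- The factor 0.57736 exceeds 1/√3, and 0.42264 completes it to 1, so a block with U near an
integer gets its trivial bound. The constant 103/3 is 1 + 10/(3D) at D = 1/10. -/
theorem norm_sum_cube_quadPhase_le {t u : ℝ} (ht : 0 < t) (hu : 0 < u) (htu : t ≤ 0.729 * u ^ 3)
    {v : ℕ} (hv : 1799 * u ≤ v) {K : ℕ} (hK0 : 0 < K) (hK : K ≤ ⌈(v : ℝ) / u⌉₊) {n : ℕ}
    (hn : 0 < n) (a b : ℝ) {U : ℝ} (hb : 8 * Real.pi * b = -(2 * Real.pi * U)) :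
    ‖∑ k ∈ Finset.range K, (Complex.I * t / 3 * ((k / (v : ℝ) : ℝ) : ℂ) ^ 3) ^ n
        / (n.factorial : ℂ) * quadPhase a b k‖
      ≤ leadCoeff n * (0.57736 * (⌈(v : ℝ) / u⌉₊ + (3 * n + 1) * (103 / 3))
        + 0.42264 * if |U - round U| < 1 / 40 then (⌈(v : ℝ) / u⌉₊ : ℝ) else 0) := by
  have hv0 : (0 : ℝ) < v := by linarith
  set D := ⌈(v : ℝ) / u⌉₊ with hD
  set w : ℕ → ℝ := fun k => ((k : ℝ) / v) ^ (3 * n) with hw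
  have hfac : (0 : ℝ) < n.factorial := by exact_mod_cast n.factorial_pos
  have hmass := pow_mul_sum_cube_le ht hu htu hv hK n
  rw [← hD] at hmass
  have heq : ∑ k ∈ Finset.range K, (Complex.I * t / 3 * ((k / (v : ℝ) : ℝ) : ℂ) ^ 3) ^ n
        / (n.factorial : ℂ) * quadPhase a b k
      = (Complex.I * t / 3) ^ n / (n.factorial : ℂ) *
        ∑ k ∈ Finset.range K, (w k : ℂ) * quadPhase a b k := by
    rw [Finset.mul_sum]
    refine Finset.sum_congr rfl fun k _ => ?_
    rw [hw, mul_pow, ← pow_mul]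
    push_cast
    ring
  have hconst : ‖(Complex.I * t / 3) ^ n / (n.factorial : ℂ)‖ = (t / 3) ^ n / n.factorial := by
    simp [abs_of_pos ht]
  rw [heq, norm_mul, hconst]
  have hlead : leadCoeff n * D = (D * (0.24341 ^ n / (3 * n + 1))) / n.factorial := by
    unfold leadCoeff; ring
  have hL := leadCoeff_nonneg n
  have hwmono : Monotone w := fun i j hij => by
    simp only [hw]; gcongr
  have hw0 : ∀ k, 0 ≤ w k := fun k => by simp only [hw]; positivity
  split_ifs with hbad
  · have htriv : ‖∑ k ∈ Finset.range K, (w k : ℂ) * quadPhase a b k‖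
        ≤ ∑ k ∈ Finset.range K, w k := by
      refine (norm_sum_le _ _).trans (Finset.sum_le_sum fun k _ => ?_)
      rw [norm_mul, norm_quadPhase, mul_one, Complex.norm_real, Real.norm_of_nonneg (hw0 k)]
    calc _ ≤ (t / 3) ^ n / n.factorial * ∑ k ∈ Finset.range K, w k := by gcongr
      _ = ((t / 3) ^ n * ∑ k ∈ Finset.range K, w k) / n.factorial := by ring
      _ ≤ leadCoeff n * D := by rw [hlead]; gcongr
      _ ≤ _ := by
          gcongr
          have : (0 : ℝ) ≤ (3 * n + 1) * (103 / 3) := by positivity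
          linarith
  · obtain ⟨K, rfl⟩ : ∃ K', K = K' + 1 := ⟨K - 1, by omega⟩
    have hgood := le_norm_exp_sub_one hb (not_lt.1 hbad)
    have hosc := norm_sum_monotone_mul_le (α := 1 / Real.sqrt 3) (β := (103 / 3) / Real.sqrt 3) K w
      -- Moving the start of a quadratic sum changes only its linear coefficient, so every tail
      -- obeys the same bound.
      (quadPhase a b) hwmono (hw0 0) (fun j _ => by
        simp only [quadPhase_add]
        rw [← Finset.mul_sum, norm_mul, norm_quadPhase, one_mul]
        refine (norm_sum_quadPhase_le _ b _ (by norm_num) hgood).trans (le_of_eq ?_)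
        norm_num
        ring)
    have hinv : 1 / Real.sqrt 3 ≤ 0.57736 := by
      rw [div_le_iff₀ (by positivity)]
      have : (1.73203 : ℝ) ≤ Real.sqrt 3 := Real.le_sqrt_of_sq_le (by norm_num)
      linarith
    have hlast : (t / 3) ^ n * w K ≤ 0.24341 ^ n := by
      have hk : (K : ℝ) < v / u := Nat.lt_ceil.1 (Nat.lt_of_succ_le hK)
      have hx : (K : ℝ) / v ≤ 1 / u := by
        rw [div_le_iff₀ hv0]
        exact hk.le.trans (le_of_eq (by ring))
      have e : (t / 3) ^ n * w K = (t / 3 * ((K : ℝ) / v) ^ 3) ^ n := by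
        rw [mul_pow, ← pow_mul]
      rw [e]
      gcongr
      calc t / 3 * ((K : ℝ) / v) ^ 3 ≤ (0.729 * u ^ 3) / 3 * (1 / u) ^ 3 := by gcongr
        _ = 0.729 / 3 := by field_simp
        _ ≤ 0.24341 := by norm_num
    have hs0 : 0 ≤ ∑ k ∈ Finset.range (K + 1), w k := Finset.sum_nonneg fun k _ => hw0 k
    have hosc' : ‖∑ k ∈ Finset.range (K + 1), (w k : ℂ) * quadPhase a b k‖
        ≤ 0.57736 * (∑ k ∈ Finset.range (K + 1), w k + 103 / 3 * w K) := by
      refine hosc.trans ?_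
      have e : 1 / Real.sqrt 3 * ∑ k ∈ Finset.range (K + 1), w k + 103 / 3 / Real.sqrt 3 * w K
          = 1 / Real.sqrt 3 * (∑ k ∈ Finset.range (K + 1), w k + 103 / 3 * w K) := by ring
      rw [e]
      have := hw0 K
      gcongr
    have hlead' : leadCoeff n * (3 * n + 1) = 0.24341 ^ n / n.factorial := by
      unfold leadCoeff
      have : (3 * n + 1 : ℝ) ≠ 0 := by positivity
      field_simp
    calc _ ≤ (t / 3) ^ n / n.factorial *
          (0.57736 * (∑ k ∈ Finset.range (K + 1), w k + 103 / 3 * w K)) := by gcongr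
      _ = 0.57736 * (((t / 3) ^ n * ∑ k ∈ Finset.range (K + 1), w k) / n.factorial
          + 103 / 3 * ((t / 3) ^ n * w K / n.factorial)) := by ring
      _ ≤ 0.57736 * (leadCoeff n * D + 103 / 3 * (leadCoeff n * (3 * n + 1))) := by
          rw [hlead, hlead']; gcongr
      _ = _ := by ring

theorem norm_block_error_le {t u : ℝ} (ht : 0 < t) (hu : 10 ^ 8 ≤ u) (htu : t ≤ 0.729 * u ^ 3)
    {v : ℕ} (hv : 1799 * u ≤ v) {K : ℕ} (hK0 : 0 < K) (hK : K ≤ ⌈(v : ℝ) / u⌉₊) {J n : ℕ}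
    (hJ : J + 3 = 3 * n) (a b : ℝ) {U : ℝ} (hb : 8 * Real.pi * b = -(2 * Real.pi * U)) :
    ‖∑ k ∈ Finset.range K,
        (fTaylor (1 / 2 - Complex.I * (t : ℂ)) ((k / (v : ℝ) : ℝ) : ℂ)
          - taylorAtZero J (fTaylor (1 / 2 - Complex.I * (t : ℂ))) ((k / (v : ℝ) : ℝ) : ℂ)) *
        quadPhase a b k‖
      ≤ leadCoeff n * (0.57736 * (⌈(v : ℝ) / u⌉₊ + (3 * n + 1) * (103 / 3))
        + 0.42264 * if |U - round U| < 1 / 40 then (⌈(v : ℝ) / u⌉₊ : ℝ) else 0)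
        + ⌈(v : ℝ) / u⌉₊ * restCoeff n := by
  have hu0 : 0 < u := by linarith
  have hv0 : (0 : ℝ) < v := by linarith
  set f := fTaylor (1 / 2 - Complex.I * (t : ℂ)) with hf
  have hmain := norm_sum_cube_quadPhase_le ht hu0 htu hv hK0 hK (n := n) (by omega) a b hb
  set x : ℕ → ℝ := fun k => k / (v : ℝ) with hx
  have hsplit : ∑ k ∈ Finset.range K, (f (x k) - taylorAtZero J f (x k)) * quadPhase a b k
      = ∑ k ∈ Finset.range K, (Complex.I * t / 3 * (x k : ℂ) ^ 3) ^ n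
        / (n.factorial : ℂ) * quadPhase a b k
      + ∑ k ∈ Finset.range K, (f (x k) - taylorAtZero J f (x k)
        - (Complex.I * t / 3 * (x k : ℂ) ^ 3) ^ n / (n.factorial : ℂ)) * quadPhase a b k := by
    rw [← Finset.sum_add_distrib]
    exact Finset.sum_congr rfl fun k _ => by ring
  refine (congrArg norm hsplit).trans_le ((norm_add_le _ _).trans (add_le_add hmain ?_))
  have hmass := pow_mul_sum_cube_le ht hu0 htu hv hK (n + 1)
  calc _ ≤ ∑ k ∈ Finset.range K, ((t / 3) ^ (n + 1) * x k ^ (3 * (n + 1))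
        * ((n + 2) / ((n + 1).factorial * (n + 1))) + 0.000561 * (1 / 3) ^ (J + 1)) := by
        refine (norm_sum_le _ _).trans (Finset.sum_le_sum fun k hk => ?_)
        rw [norm_mul, norm_quadPhase, mul_one]
        have hk' : (k : ℝ) < v / u := Nat.lt_ceil.1 ((Finset.mem_range.1 hk).trans_le hK)
        have hxk : x k ≤ 1 / u := by
          simp only [hx]
          rw [div_le_iff₀ hv0]
          exact hk'.le.trans (le_of_eq (by ring))
        refine (norm_fTaylor_sub_taylor_sub_le ht hu htu (by simp only [hx]; positivity) hxk
          hJ).trans (le_of_eq ?_)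
        rw [pow_mul, ← mul_pow]
        ring_nf
    _ = ((t / 3) ^ (n + 1) * ∑ k ∈ Finset.range K, x k ^ (3 * (n + 1)))
        * ((n + 2) / ((n + 1).factorial * (n + 1))) + K * (0.000561 * (1 / 3) ^ (J + 1)) := by
        rw [Finset.sum_add_distrib, ← Finset.sum_mul, ← Finset.mul_sum, Finset.sum_const,
          Finset.card_range, nsmul_eq_mul]
    _ ≤ (⌈(v : ℝ) / u⌉₊ * (0.24341 ^ (n + 1) / (3 * (n + 1 : ℕ) + 1)))
        * ((n + 2) / ((n + 1).factorial * (n + 1)))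
        + ⌈(v : ℝ) / u⌉₊ * (0.000561 * (1 / 3) ^ (J + 1)) := by gcongr
    _ = _ := by
        rw [restCoeff, show 3 * n - 2 = J + 1 by omega]
        push_cast
        ring

/-- Discrete forms of ∫ v^{-1/2} dv = 2√v and u∫ v^{-3/2} dv = -2u/√v. A step multiplies √v by at
most 1 + 10^{-8}, which accounts for the correction factors. -/
theorem step_div_sqrt_le {u v v' : ℝ} (hu : 10 ^ 8 ≤ u) (hv : 0 < v)
    (h1 : v + v / u ≤ v') (h2 : v' ≤ v + v / u * (1800 / 1799)) :
    (v' - v) / Real.sqrt v ≤ 2 * (1 + 1 / 10 ^ 8) * (Real.sqrt v' - Real.sqrt v) ∧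
    1 / Real.sqrt v ≤ 2 * u * (1 + 1 / 10 ^ 7) * (1 / Real.sqrt v - 1 / Real.sqrt v') := by
  have hu0 : 0 < u := by linarith
  have hvu : 0 < v / u := by positivity
  have hv' : 0 < v' := by linarith
  have hvu' : v / u ≤ v / 10 ^ 8 := by gcongr
  set s := Real.sqrt v with hs
  set s' := Real.sqrt v' with hs'
  have hs0 : 0 < s := Real.sqrt_pos.2 hv
  have hs'0 : 0 < s' := Real.sqrt_pos.2 hv'
  have es : s ^ 2 = v := Real.sq_sqrt hv.le
  have es' : s' ^ 2 = v' := Real.sq_sqrt hv'.le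
  have hle : s ≤ s' := Real.sqrt_le_sqrt (by linarith)
  have hss : s' ≤ (1 + 1 / 10 ^ 8) * s := by
    refine abs_le_of_sq_le_sq' ?_ (by positivity) |>.2
    rw [mul_pow, es, es']
    norm_num at hvu' h2 ⊢
    linarith
  constructor
  · rw [div_le_iff₀ hs0, ← es, ← es']
    have : 0 ≤ s' - s := sub_nonneg.2 hle
    nlinarith [mul_nonneg this hs0.le]
  · have hd : s ^ 2 ≤ u * (s' ^ 2 - s ^ 2) := by
      rw [es, es']
      have : v / u ≤ v' - v := by linarith
      calc v = u * (v / u) := by field_simp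
        _ ≤ _ := by gcongr
    have e : 1 / s - 1 / s' = (s' - s) / (s * s') := by field_simp
    rw [e, ← mul_div_assoc, div_le_div_iff₀ hs0 (by positivity), one_mul]
    have h3 : s * s ≤ u * ((s' - s) * (s' + s)) := by nlinarith
    have h4 : s * s * s' ≤ u * ((s' - s) * (s' + s)) * s' := by gcongr
    have h5 : (s' + s) * s' ≤ 2 * (1 + 1 / 10 ^ 7) * (s * s) := by
      have a1 : s' + s ≤ (2 + 1 / 10 ^ 8) * s := by linarith
      calc (s' + s) * s' ≤ ((2 + 1 / 10 ^ 8) * s) * ((1 + 1 / 10 ^ 8) * s) := by gcongr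
        _ ≤ _ := by
          have : 0 < s * s := by positivity
          norm_num
          nlinarith
    have h6 : 0 ≤ u * (s' - s) := mul_nonneg hu0.le (sub_nonneg.2 hle)
    have h7 := mul_le_mul_of_nonneg_left h5 h6
    have h8 : s * (s * s') ≤ s * (2 * u * (1 + 1 / 10 ^ 7) * (s' - s) * s) := by nlinarith
    exact le_of_mul_le_mul_left h8 hs0

end RSTruncation

/-! ### Summation over blocks and the share of near-integer curvature -/

namespace RSTruncation

theorem sqrt_eq_mul_exp_neg_log {t v : ℝ} (ht : 0 < t) (hv : 0 < v) :
    Real.sqrt v = Real.sqrt (Real.sqrt (t / Real.pi))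
      * Real.exp (-(Real.log (t / (Real.pi * v ^ 2)) / 4)) := by
  have hpi := Real.pi_pos
  have htp : 0 < t / Real.pi := by positivity
  rw [← Real.exp_log (Real.sqrt_pos.2 hv), ← Real.exp_log (Real.sqrt_pos.2 (Real.sqrt_pos.2 htp)),
    ← Real.exp_add, Real.log_sqrt hv.le, Real.log_sqrt (Real.sqrt_nonneg _), Real.log_sqrt htp.le,
    ← div_div, Real.log_div htp.ne' (by positivity), Real.log_pow]
  push_cast
  ring_nf

/-- Along one block U falls by a relative amount of at most 3/u, while U ≤ u/10^6; the drop is far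
below 1/40. -/
theorem le_curvature_of_step {t u v v' q : ℝ} (ht : 0 < t) (hu : 10 ^ 8 ≤ u)
    (htu : t ≤ 0.729 * u ^ 3) (hv : 1799 * u ≤ v) (h1 : v ≤ v')
    (h2 : v' ≤ v + v / u * (1800 / 1799)) (hq : q - 1 / 40 < t / (Real.pi * v ^ 2)) :
    q - 1 / 20 ≤ t / (Real.pi * v' ^ 2) := by
  have hu0 : 0 < u := by linarith
  have hv0 : 0 < v := by linarith
  have hv'0 : 0 < v' := by linarith
  have hpi := Real.pi_gt_three
  set U := t / (Real.pi * v ^ 2) with hU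
  have hU0 : 0 < U := by positivity
  have hUu : U ≤ u / 10 ^ 6 := by
    calc U ≤ (0.729 * u ^ 3) / (3 * (1799 * u) ^ 2) := by rw [hU]; gcongr
      _ = (0.729 / (3 * 1799 ^ 2)) * u := by field_simp
      _ ≤ 1 / 10 ^ 6 * u := mul_le_mul_of_nonneg_right (by norm_num) hu0.le
      _ = _ := by ring
  set y := v' / v with hy
  have hy1 : 1 ≤ y := (one_le_div hv0).2 h1
  have hinv : 1 / u ≤ 1 / 10 ^ 8 := one_div_le_one_div_of_le (by norm_num) hu
  have hinv0 : 0 < 1 / u := by positivity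
  have hy2 : y ≤ 1 + 1 / u * (1800 / 1799) := by
    rw [hy, div_le_iff₀ hv0]
    exact h2.trans (le_of_eq (by ring))
  have hysq : y ^ 2 - 1 ≤ 3 * (1 / u) := by
    have : y ^ 2 ≤ (1 + 1 / u * (1800 / 1799)) ^ 2 := by gcongr
    have hz : 1 / u * (1 / u) ≤ 1 / 10 ^ 8 * (1 / u) := by gcongr
    nlinarith
  have hU' : t / (Real.pi * v' ^ 2) = U / y ^ 2 := by
    rw [hU, hy]; field_simp
  rw [hU']
  have hdiff : U - U / y ^ 2 ≤ U * (y ^ 2 - 1) := by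
    have hy21 : 1 ≤ y ^ 2 := one_le_pow₀ hy1
    rw [sub_le_iff_le_add, ← sub_le_iff_le_add', le_div_iff₀ (by positivity)]
    nlinarith [mul_nonneg hU0.le (mul_nonneg (sub_nonneg.2 hy21) (sub_nonneg.2 hy21))]
  have hfin : U * (y ^ 2 - 1) ≤ 1 / 40 := by
    calc U * (y ^ 2 - 1) ≤ (u / 10 ^ 6) * (3 * (1 / u)) := by
          gcongr
          exact sub_nonneg.2 (one_le_pow₀ hy1)
      _ = 3 / 10 ^ 6 := by field_simp
      _ ≤ 1 / 40 := by norm_num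
  linarith

-- The bad blocks are grouped by the nearest integer q ≥ 2. Each group lies over q - 1/20 ≤ U ≤ q +
-- 1/40, where the lower margin allows for the end of the last block. Convexity charges it to 3/40
-- of the increment over [q - 1, q], and these increments telescope down from U = 1.
open Finset in
theorem sum_bad_increments_le {t u : ℝ} (ht : 0 < t) (hu : 10 ^ 8 ≤ u) (htu : t ≤ 0.729 * u ^ 3)
    {v : ℕ → ℝ} (hv : ∀ r, 1799 * u ≤ v r) (h1 : ∀ r, v r ≤ v (r + 1))
    (h2 : ∀ r, v (r + 1) ≤ v r + v r / u * (1800 / 1799)) (S : Finset ℕ)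
    (hS : ∀ r ∈ S, 2 ≤ t / (Real.pi * v r ^ 2) ∧
      |t / (Real.pi * v r ^ 2) - round (t / (Real.pi * v r ^ 2))| < 1 / 40) :
    ∑ r ∈ S, (Real.sqrt (v (r + 1)) - Real.sqrt (v r))
      ≤ 3 / 40 * Real.sqrt (Real.sqrt (t / Real.pi)) := by
  have hu0 : 0 < u := by linarith
  have hv0 : ∀ r, 0 < v r := fun r => by linarith [hv r]
  set U : ℕ → ℝ := fun r => t / (Real.pi * v r ^ 2) with hU
  set κ := Real.sqrt (Real.sqrt (t / Real.pi)) with hκ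
  have hκ0 : 0 ≤ κ := Real.sqrt_nonneg _
  set g : ℝ → ℝ := fun x => Real.exp (-(Real.log x / 4)) with hg
  have hanti : ∀ {x y : ℝ}, 0 < x → x ≤ y → g y ≤ g x := fun {x y} hx hxy => by
    have := Real.log_le_log hx hxy
    exact Real.exp_le_exp.2 (by linarith)
  have hsqrt : ∀ r, Real.sqrt (v r) = κ * g (U r) := fun r => sqrt_eq_mul_exp_neg_log ht (hv0 r)
  have hG : Monotone fun r => Real.sqrt (v r) :=
    monotone_nat_of_le_succ fun r => Real.sqrt_le_sqrt (h1 r)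
  -- The groups are numbered from 0 by q - 2; the truncated subtraction is harmless because q ≥ 2 on
  -- S.
  set c : ℕ → ℕ := fun r => (round (U r)).toNat - 2 with hc
  have hcU : ∀ r ∈ S, |U r - ((c r : ℝ) + 2)| < 1 / 40 := by
    intro r hr
    have h := hS r hr
    have hround : 2 ≤ round (U r) := by
      have hU2 : 2 ≤ U r := h.1
      have := (abs_lt.1 h.2).2
      have h3 : (1 : ℝ) < round (U r) := by
        change U r - round (U r) < 1 / 40 at this
        linarith
      have h4 : (1 : ℤ) < round (U r) := by exact_mod_cast h3
      omega
    have hcast : ((c r : ℕ) : ℤ) + 2 = round (U r) := by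
      simp only [hc]; omega
    have : (c r : ℝ) + 2 = (round (U r) : ℝ) := by exact_mod_cast hcast
    rw [this]
    exact h.2
  have hmaps : ∀ r ∈ S, c r ∈ range (S.sup c + 1) := fun r hr =>
    mem_range.2 (Nat.lt_succ_of_le (le_sup hr))
  rw [← sum_fiberwise_of_maps_to hmaps]
  have hfib : ∀ i ∈ range (S.sup c + 1),
      ∑ r ∈ S with c r = i, (Real.sqrt (v (r + 1)) - Real.sqrt (v r))
        ≤ 3 / 40 * κ * (g ((i : ℝ) + 1) - g (((i + 1 : ℕ) : ℝ) + 1)) := by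
    intro i _
    have hi : (0 : ℝ) ≤ i := Nat.cast_nonneg i
    have hconv := exp_neg_log_div_four_sub_le (q := (i : ℝ) + 2) (by linarith)
    rw [show (i : ℝ) + 2 - 1 = i + 1 by ring] at hconv
    refine (sum_increments_le hG _ (a := κ * g ((i : ℝ) + 2 + 1 / 40))
      (b := κ * g ((i : ℝ) + 2 - 1 / 20)) ?_ ?_ ?_).trans ?_
    · exact mul_le_mul_of_nonneg_left (hanti (by linarith) (by linarith)) hκ0
    · intro r hr
      obtain ⟨hrS, rfl⟩ := mem_filter.1 hr
      have h := abs_lt.1 (hcU r hrS)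
      have hUpos : 0 < U r := by linarith [(hS r hrS).1]
      simp only [hsqrt]
      exact mul_le_mul_of_nonneg_left (hanti hUpos (by linarith)) hκ0
    · intro r hr
      obtain ⟨hrS, rfl⟩ := mem_filter.1 hr
      have h := abs_lt.1 (hcU r hrS)
      rw [hsqrt]
      refine mul_le_mul_of_nonneg_left (hanti (by linarith) ?_) hκ0
      exact le_curvature_of_step ht hu htu (hv r) (h1 r) (h2 r)
        (by change _ < U r; linarith)
    · push_cast
      rw [← mul_sub, show (i : ℝ) + 1 + 1 = i + 2 by ring]
      calc _ ≤ κ * (3 / 40 * (g (i + 1) - g (i + 2))) := mul_le_mul_of_nonneg_left hconv hκ0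
        _ = _ := by ring
  refine (sum_le_sum hfib).trans ?_
  rw [← mul_sum, sum_range_sub' (fun i : ℕ => g ((i : ℝ) + 1))]
  have hg1 : g (((0 : ℕ) : ℝ) + 1) = 1 := by simp [hg]
  have hgpos : 0 ≤ g (((S.sup c + 1 : ℕ) : ℝ) + 1) := (Real.exp_pos _).le
  rw [hg1]
  nlinarith

/-- `S₁`, `S₀` and `S_bad` bound the sums over blocks of D/√v, of 1/√v, and of D/√v over the bad
blocks, where D is the rounded block length. -/
theorem norm_truncError_le_of_params {t u : ℝ} (ht : 0 < t) (hu : 10 ^ 8 ≤ u)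
    (htu : t ≤ 0.729 * u ^ 3) {v₀ : ℕ} (hv : 1799 * u ≤ v₀) (hN : v₀ ≤ mainLength t) {J n : ℕ}
    (hJ : J + 3 = 3 * n) {S₁ S₀ S_bad : ℝ}
    (hS₁ : 2 * (1 + 1 / 10 ^ 8) * ((1 + 1 / 10 ^ 8) * Real.sqrt (Real.sqrt (t / (2 * Real.pi)))
      - Real.sqrt v₀) ≤ S₁)
    (hS₀ : 2 * u * (1 + 1 / 10 ^ 7) * (1 / Real.sqrt v₀) ≤ S₀)
    (hSb : 2 * (1 + 1 / 10 ^ 8) * (3 / 40 * Real.sqrt (Real.sqrt (t / Real.pi))) ≤ S_bad) :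
    ‖truncError J t u v₀‖ ≤ leadCoeff n * (0.57736 * (S₁ + (3 * n + 1) * (103 / 3) * S₀)
      + 0.42264 * S_bad) + S₁ * restCoeff n := by
  have hu0 : 0 < u := by linarith
  have hv₀ : 0 < v₀ := by
    have : (0 : ℝ) < v₀ := by linarith
    exact_mod_cast this
  set v : ℕ → ℕ := blockStart u v₀ with hvdef
  set D : ℕ → ℝ := fun r => (⌈(v r : ℝ) / u⌉₊ : ℝ) with hD
  have hvr : ∀ r, 1799 * u ≤ (v r : ℝ) := fun r =>
    hv.trans (by exact_mod_cast le_blockStart u v₀ r)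
  have hvpos : ∀ r, (0 : ℝ) < v r := fun r => by linarith [hvr r]
  have hsucc : ∀ r, ((v (r + 1) : ℕ) : ℝ) = v r + D r := fun r => by
    rw [hvdef, blockStart]; push_cast; rfl
  have hDb : ∀ r, (v r : ℝ) / u ≤ D r ∧ D r ≤ v r / u * (1800 / 1799) := fun r =>
    ceil_div_bounds hu0 (hvr r)
  have hD0 : ∀ r, 0 ≤ D r := fun r => Nat.cast_nonneg _
  have hstep : ∀ r, D r / Real.sqrt (v r)
        ≤ 2 * (1 + 1 / 10 ^ 8) * (Real.sqrt (v (r + 1) : ℕ) - Real.sqrt (v r)) ∧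
      1 / Real.sqrt (v r) ≤ 2 * u * (1 + 1 / 10 ^ 7)
        * (1 / Real.sqrt (v r) - 1 / Real.sqrt (v (r + 1) : ℕ)) := by
    intro r
    have h := step_div_sqrt_le hu (hvpos r) (v' := (v (r + 1) : ℕ))
      (by rw [hsucc]; linarith [hDb r]) (by rw [hsucc]; linarith [hDb r])
    rwa [hsucc, add_sub_cancel_left, ← hsucc] at h
  set M := lastBlock t u v₀ + 1 with hM
  set U : ℕ → ℝ := fun r => t / (Real.pi * (v r : ℝ) ^ 2) with hU
  have hpi := Real.pi_pos
  set N₁ := Real.sqrt (t / (2 * Real.pi)) with hN₁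
  have hN₁0 : 0 < N₁ := Real.sqrt_pos.2 (by positivity)
  have hNN : (mainLength t : ℝ) ≤ N₁ := Nat.floor_le hN₁0.le
  have hlast : ∀ r ∈ Finset.range M, (v r : ℝ) ≤ N₁ := fun r hr => by
    have : v r ≤ mainLength t :=
      (blockStart_mono u v₀ (Nat.lt_succ_iff.1 (Finset.mem_range.1 hr))).trans
        (lastBlock_spec hu0 hv₀ hN).1
    exact (by exact_mod_cast this : (v r : ℝ) ≤ mainLength t).trans hNN
  -- This is v_r ≤ √(t/(2π)), the cutoff of the main sum.
  have hU2 : ∀ r ∈ Finset.range M, 2 ≤ U r := fun r hr => by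
    have h := hlast r hr
    have hsq : (v r : ℝ) ^ 2 ≤ t / (2 * Real.pi) := by
      calc (v r : ℝ) ^ 2 ≤ N₁ ^ 2 := by have := hvpos r; gcongr
        _ = _ := Real.sq_sqrt (by positivity)
    have hvp := hvpos r
    rw [le_div_iff₀ (by positivity)] at hsq ⊢
    linarith
  have hsum₁ : ∑ r ∈ Finset.range M, D r / Real.sqrt (v r) ≤ S₁ := by
    refine le_trans ?_ hS₁
    calc _ ≤ ∑ r ∈ Finset.range M, 2 * (1 + 1 / 10 ^ 8)
          * (Real.sqrt (v (r + 1) : ℕ) - Real.sqrt (v r)) :=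
          Finset.sum_le_sum fun r _ => (hstep r).1
      _ = 2 * (1 + 1 / 10 ^ 8) * (Real.sqrt (v M) - Real.sqrt (v 0)) := by
          rw [← Finset.mul_sum, Finset.sum_range_sub (fun r => Real.sqrt (v r))]
      _ ≤ _ := by
          have h0 : v 0 = v₀ := rfl
          rw [h0]
          have hR := hlast (lastBlock t u v₀) (Finset.self_mem_range_succ _)
          -- The unshortened final block may overshoot √(t/(2π)), but only by one step.
          have hvM : ((v M : ℕ) : ℝ) ≤ (1 + 1 / 10 ^ 8) ^ 2 * N₁ := by
            have hvl := hvpos (lastBlock t u v₀)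
            have hvu : (v (lastBlock t u v₀) : ℝ) / u ≤ v (lastBlock t u v₀) / 10 ^ 8 := by gcongr
            rw [hM, hsucc]
            have := (hDb (lastBlock t u v₀)).2
            norm_num at hvu ⊢
            linarith
          have hs : Real.sqrt (v M) ≤ (1 + 1 / 10 ^ 8) * Real.sqrt N₁ := by
            refine (Real.sqrt_le_sqrt hvM).trans (le_of_eq ?_)
            rw [Real.sqrt_mul (by positivity), Real.sqrt_sq (by positivity)]
          gcongr
  have hsum₀ : ∑ r ∈ Finset.range M, 1 / Real.sqrt (v r) ≤ S₀ := by
    refine le_trans ?_ hS₀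
    calc _ ≤ ∑ r ∈ Finset.range M, 2 * u * (1 + 1 / 10 ^ 7)
          * (1 / Real.sqrt (v r) - 1 / Real.sqrt (v (r + 1) : ℕ)) :=
          Finset.sum_le_sum fun r _ => (hstep r).2
      _ = 2 * u * (1 + 1 / 10 ^ 7) * (1 / Real.sqrt (v 0) - 1 / Real.sqrt (v M)) := by
          rw [← Finset.mul_sum, Finset.sum_range_sub' (fun r => 1 / Real.sqrt (v r))]
      _ ≤ _ := by
          have h0 : v 0 = v₀ := rfl
          rw [h0]
          gcongr
          have : 0 ≤ 1 / Real.sqrt (v M) := by positivity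
          linarith
  have hsumb : ∑ r ∈ Finset.range M, (if |U r - round (U r)| < 1 / 40 then D r else 0)
      / Real.sqrt (v r) ≤ S_bad := by
    refine le_trans ?_ hSb
    have hbad := sum_bad_increments_le ht hu htu (v := fun r => (v r : ℝ)) hvr
      (fun r => by rw [hsucc]; linarith [hD0 r]) (fun r => by rw [hsucc]; linarith [hDb r])
      ((Finset.range M).filter fun r => |U r - round (U r)| < 1 / 40) (fun r hr => by
        obtain ⟨hr1, hr2⟩ := Finset.mem_filter.1 hr
        exact ⟨hU2 r hr1, hr2⟩)
    calc _ = ∑ r ∈ Finset.range M with |U r - round (U r)| < 1 / 40, D r / Real.sqrt (v r) := by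
          rw [Finset.sum_filter]
          refine Finset.sum_congr rfl fun r _ => ?_
          split_ifs <;> simp
      _ ≤ ∑ r ∈ Finset.range M with |U r - round (U r)| < 1 / 40, 2 * (1 + 1 / 10 ^ 8)
          * (Real.sqrt (v (r + 1) : ℕ) - Real.sqrt (v r)) :=
          Finset.sum_le_sum fun r _ => (hstep r).1
      _ ≤ _ := by
          rw [← Finset.mul_sum]
          gcongr
  have hu1 : 1 < u := by linarith
  have hA := leadCoeff_nonneg n
  have hB := restCoeff_nonneg n
  calc ‖truncError J t u v₀‖ ≤ _ := norm_truncError_le hu1 hv₀ hN J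
    _ ≤ ∑ r ∈ Finset.range M, 1 / Real.sqrt (v r) * (leadCoeff n
        * (0.57736 * (D r + (3 * n + 1) * (103 / 3))
          + 0.42264 * if |U r - round (U r)| < 1 / 40 then D r else 0) + D r * restCoeff n) := by
        refine Finset.sum_le_sum fun r hr => ?_
        have hr' : r ≤ lastBlock t u v₀ := Nat.lt_succ_iff.1 (Finset.mem_range.1 hr)
        refine mul_le_mul_of_nonneg_left ?_ (by positivity)
        refine norm_block_error_le ht hu htu (hvr r) (blockLength_pos hu0 hv₀ hN hr')
          (blockLength_le t u v₀ r) hJ _ _ (U := U r) ?_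
        have hvp := hvpos r
        rw [quadArg, hU, hvdef]
        field_simp
        norm_num
    _ = leadCoeff n * (0.57736 * (∑ r ∈ Finset.range M, D r / Real.sqrt (v r)
          + (3 * n + 1) * (103 / 3) * ∑ r ∈ Finset.range M, 1 / Real.sqrt (v r))
          + 0.42264 * ∑ r ∈ Finset.range M, (if |U r - round (U r)| < 1 / 40 then D r else 0)
            / Real.sqrt (v r)) + (∑ r ∈ Finset.range M, D r / Real.sqrt (v r)) * restCoeff n := by
        simp only [Finset.mul_sum, Finset.sum_mul, ← Finset.sum_add_distrib]
        refine Finset.sum_congr rfl fun r _ => ?_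
        ring
    _ ≤ _ := by gcongr

/-! ### The chosen parameters and the numerical table -/

/-- Since 0.729 = 0.9³, the quantity 0.729u³ is exactly |s|, which lies between t and t + 1/2. -/
theorem chosenU_bounds {t : ℝ} (ht : 10 ^ 24 ≤ t) :
    10 ^ 8 ≤ chosenU t ∧ t ≤ 0.729 * chosenU t ^ 3 ∧
      chosenU t ≤ 1.11112 * t ^ ((1 : ℝ) / 3) := by
  have ht0 : 0 < t := by linarith
  have hcube : ∀ {y : ℝ}, 0 ≤ y → (y ^ ((1 : ℝ) / 3)) ^ 3 = y := fun {y} hy => by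
    rw [← Real.rpow_natCast, ← Real.rpow_mul hy]; norm_num
  set w := ‖(1 / 2 + Complex.I * (t : ℂ) : ℂ)‖ with hw
  have hlow : t ≤ w := by
    have := Complex.abs_im_le_norm (1 / 2 + Complex.I * (t : ℂ))
    rw [hw]
    refine le_trans (le_of_eq ?_) this
    simp [abs_of_pos ht0]
  have hup : w ≤ t + 1 / 2 := by
    refine (norm_add_le _ _).trans (le_of_eq ?_)
    simp [abs_of_pos ht0]
    ring
  have hw0 : 0 ≤ w := norm_nonneg _
  have hu : chosenU t = (1 / 0.9) * w ^ ((1 : ℝ) / 3) := rfl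
  have hu3 : 0.729 * chosenU t ^ 3 = w := by
    rw [hu, mul_pow, hcube hw0]; ring
  have hu0 : 0 ≤ chosenU t := by rw [hu]; positivity
  refine ⟨?_, hu3 ▸ hlow, ?_⟩
  · refine le_of_pow_le_pow_left₀ (n := 3) (by norm_num) hu0 ?_
    norm_num at hu3 ht ⊢
    linarith
  · refine le_of_pow_le_pow_left₀ (n := 3) (by norm_num) (by positivity) ?_
    rw [mul_pow, hcube ht0.le]
    norm_num at hu3 ht ⊢
    linarith

/-- Rational x, y, m with x ≤ t^{1/6} ≤ y and m ≥ (t/(2π))^{1/4} make the bound a rational number.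
The constants 44.721 and 1.18922 are a lower bound for √2000 and an upper bound for 2^{1/4}. -/
theorem norm_truncError_chosen_le {t : ℝ} (ht : 10 ^ 24 ≤ t) {x y m : ℝ} (hx0 : 0 < x)
    (hy0 : 0 < y) (hm0 : 0 < m) (hx : x ^ 6 ≤ t) (hy : t ≤ y ^ 6) (hm : t ≤ 2 * 3.141592 * m ^ 4)
    {n J : ℕ} (hJ : J + 3 = 3 * n) :
    ‖truncError J t (chosenU t) (chosenV t)‖ ≤
      leadCoeff n * (0.57736 * (2.00000002 * (1.00000001 * m - 44.721 * x)
          + (3 * n + 1) * (103 / 3) * (2.222241 * y ^ 2 / (44.721 * x)))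
        + 0.42264 * (0.15000001 * (1.18922 * m)))
      + 2.00000002 * (1.00000001 * m - 44.721 * x) * restCoeff n := by
  have ht0 : 0 < t := by linarith
  have hpi := Real.pi_pos
  have hpi6 := Real.pi_gt_d6
  obtain ⟨hu, htu, huτ⟩ := chosenU_bounds ht
  set u := chosenU t with hudef
  set τ := t ^ ((1 : ℝ) / 3) with hτ
  have hτ0 : 0 < τ := by positivity
  have hτ3 : τ ^ 3 = t := by
    rw [hτ, ← Real.rpow_natCast, ← Real.rpow_mul ht0.le]; norm_num
  have hτ8 : 10 ^ 8 ≤ τ := by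
    refine le_of_pow_le_pow_left₀ (n := 3) (by norm_num) hτ0.le ?_
    rw [hτ3]
    norm_num at ht ⊢
    exact ht
  have hxτ : x ^ 2 ≤ τ := by
    refine le_of_pow_le_pow_left₀ (n := 3) (by norm_num) hτ0.le ?_
    rw [hτ3, ← pow_mul]
    exact hx
  have hyτ : τ ≤ y ^ 2 := by
    refine le_of_pow_le_pow_left₀ (n := 3) (by norm_num) (by positivity) ?_
    rw [hτ3, ← pow_mul]
    exact hy
  have hv : 2000 * τ ≤ chosenV t := Nat.le_ceil _
  have hN : chosenV t ≤ mainLength t := by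
    refine Nat.le_floor ?_
    have h1 : (chosenV t : ℝ) ≤ 2000 * τ + 1 := (Nat.ceil_lt_add_one (by positivity)).le
    refine h1.trans (Real.le_sqrt_of_sq_le ?_)
    rw [le_div_iff₀ (by positivity), ← hτ3]
    calc (2000 * τ + 1) ^ 2 * (2 * Real.pi) ≤ (2001 * τ) ^ 2 * (2 * 4) := by
          gcongr
          · linarith
          · exact Real.pi_le_four
      _ = (2001 ^ 2 * 8) * τ ^ 2 := by ring
      _ ≤ τ * τ ^ 2 := by gcongr; norm_num at hτ8 ⊢; linarith
      _ = τ ^ 3 := by ring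
  have hsv : 44.721 * x ≤ Real.sqrt (chosenV t) := by
    refine Real.le_sqrt_of_sq_le ?_
    rw [mul_pow]
    have : (0 : ℝ) ≤ x ^ 2 := by positivity
    norm_num
    linarith
  have hsx : 0 < 44.721 * x := by positivity
  have hm1 : Real.sqrt (Real.sqrt (t / (2 * Real.pi))) ≤ m := by
    refine Real.sqrt_le_iff.2 ⟨hm0.le, Real.sqrt_le_iff.2 ⟨by positivity, ?_⟩⟩
    rw [div_le_iff₀ (by positivity), ← pow_mul]
    have : 0 ≤ m ^ 4 := by positivity
    norm_num at hpi6 hm ⊢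
    nlinarith
  have hm2 : Real.sqrt (Real.sqrt (t / Real.pi)) ≤ 1.18922 * m := by
    refine Real.sqrt_le_iff.2 ⟨by positivity, Real.sqrt_le_iff.2 ⟨by positivity, ?_⟩⟩
    rw [div_le_iff₀ (by positivity), ← pow_mul, mul_pow]
    have : 0 ≤ m ^ 4 := by positivity
    norm_num at hpi6 hm ⊢
    nlinarith
  refine norm_truncError_le_of_params ht0 hu htu ?_ hN hJ ?_ ?_ ?_
  · linarith
  · calc _ ≤ 2 * (1 + 1 / 10 ^ 8) * ((1 + 1 / 10 ^ 8) * m - 44.721 * x) := by gcongr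
      _ = _ := by norm_num
  · calc 2 * u * (1 + 1 / 10 ^ 7) * (1 / Real.sqrt (chosenV t))
        ≤ 2 * (1.11112 * y ^ 2) * (1 + 1 / 10 ^ 7) * (1 / (44.721 * x)) := by
          gcongr
          exact huτ.trans (by gcongr)
      _ = (2 * 1.11112 * (1 + 1 / 10 ^ 7)) * y ^ 2 / (44.721 * x) := by ring
      _ ≤ _ := by gcongr; norm_num
  · calc _ ≤ 2 * (1 + 1 / 10 ^ 8) * (3 / 40 * (1.18922 * m)) := by gcongr
      _ = (2 * (1 + 1 / 10 ^ 8) * (3 / 40)) * (1.18922 * m) := by ring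
      _ ≤ _ := by gcongr; norm_num

end RSTruncation

theorem proposition1 (i : Fin 7) (k : Fin 5) :
    ‖RSTruncation.truncError (RSTruncation.tableJ k) (RSTruncation.tableT i)
        (RSTruncation.chosenU (RSTruncation.tableT i))
        (RSTruncation.chosenV (RSTruncation.tableT i))‖
      ≤ RSTruncation.tableBound i k := by
  -- The orders 18, 21, 24, 27, 30 correspond to n = 7, …, 11.
  have hJ : RSTruncation.tableJ k + 3 = 3 * (k + 7 : ℕ) := by fin_cases k <;> rfl
  fin_cases i
  · refine (RSTruncation.norm_truncError_chosen_le (t := 10 ^ 24) (x := 10000) (y := 10000)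
      (m := 631618.82) (by norm_num) (by norm_num) (by norm_num) (by norm_num) (by norm_num)
      (by norm_num) (by norm_num) hJ).trans ?_
    fin_cases k <;> norm_num [RSTruncation.leadCoeff, RSTruncation.restCoeff,
      RSTruncation.tableBound, Nat.factorial]
  · refine (RSTruncation.norm_truncError_chosen_le (t := 10 ^ 26) (x := 21544.34) (y := 21544.35)
      (m := 1997354.06) (by norm_num) (by norm_num) (by norm_num) (by norm_num) (by norm_num)
      (by norm_num) (by norm_num) hJ).trans ?_
    fin_cases k <;> norm_num [RSTruncation.leadCoeff, RSTruncation.restCoeff,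
      RSTruncation.tableBound, Nat.factorial]
  · refine (RSTruncation.norm_truncError_chosen_le (t := 10 ^ 28) (x := 46415.88) (y := 46415.89)
      (m := 6316188.11) (by norm_num) (by norm_num) (by norm_num) (by norm_num) (by norm_num)
      (by norm_num) (by norm_num) hJ).trans ?_
    fin_cases k <;> norm_num [RSTruncation.leadCoeff, RSTruncation.restCoeff,
      RSTruncation.tableBound, Nat.factorial]
  · refine (RSTruncation.norm_truncError_chosen_le (t := 10 ^ 30) (x := 100000) (y := 100000)
      (m := 19973540.55) (by norm_num) (by norm_num) (by norm_num) (by norm_num) (by norm_num)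
      (by norm_num) (by norm_num) hJ).trans ?_
    fin_cases k <;> norm_num [RSTruncation.leadCoeff, RSTruncation.restCoeff,
      RSTruncation.tableBound, Nat.factorial]
  · refine (RSTruncation.norm_truncError_chosen_le (t := 10 ^ 32) (x := 215443.46) (y := 215443.47)
      (m := 63161881.06) (by norm_num) (by norm_num) (by norm_num) (by norm_num) (by norm_num)
      (by norm_num) (by norm_num) hJ).trans ?_
    fin_cases k <;> norm_num [RSTruncation.leadCoeff, RSTruncation.restCoeff,
      RSTruncation.tableBound, Nat.factorial]
  · refine (RSTruncation.norm_truncError_chosen_le (t := 10 ^ 34) (x := 464158.88) (y := 464158.89)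
      (m := 199735405.45) (by norm_num) (by norm_num) (by norm_num) (by norm_num) (by norm_num)
      (by norm_num) (by norm_num) hJ).trans ?_
    fin_cases k <;> norm_num [RSTruncation.leadCoeff, RSTruncation.restCoeff,
      RSTruncation.tableBound, Nat.factorial]
  · refine (RSTruncation.norm_truncError_chosen_le (t := 10 ^ 36) (x := 1000000) (y := 1000000)
      (m := 631618810.60) (by norm_num) (by norm_num) (by norm_num) (by norm_num) (by norm_num)
      (by norm_num) (by norm_num) hJ).trans ?_
    fin_cases k <;> norm_num [RSTruncation.leadCoeff, RSTruncation.restCoeff,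
      RSTruncation.tableBound, Nat.factorial]
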